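/- **Notation.** For an integer $K>0$ and real $a,b$ put $F(K;a,b)=\sum_{k=0}^{K}e^{2\pi i a k+2\pi i b k^2}$. For $\epsilon\in(0,e^{-1})$ put $\nu=\log(K/\epsilon)$ and $M=\lceil K^3e^{\nu}\rceil$. Put $p_a=\lceil a\rceil$, $q_a=\lfloor a+2bK\rfloor$, $p_{1,a}=q_a-p_a$, $\omega_a=\{a+2bK\}$ (fractional part), $\omega_{1,a}=\lceil a\rceil-a$, $K^*=\lfloor 2bK\rfloor$, and $\delta_n=1$ if $n=0$, $\delta_n=0$ otherwise. Put $$J(K;N,w,b)=\int_0^K e^{-2\pi wt-2\pi i bt^2}\,\frac{1-e^{-2\pi Nt}}{e^{2\pi t}-1}\,dt,\qquad \tilde I_C(K;w,b)=\int_C e^{-2\pi wt-2\pi i bt^2}\,dt,$$ where $C$ is $C_0=\{t: 0\le t<K\}$ or $C_7=\{e^{-\pi i/4}t: 0\le t<\sqrt2K\}$. **Lemma 6.6.** There are absolute implied constants for which the following holds. Let $\epsilon\in(0,e^{-1})$, let $K>0$ be an integer, and let $(\alpha,a,b)\in[-1,1]\times[0,2]\times[0,1/4]$ be such that, for all $x\in[-1/4,1/4]$,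 with $A=a+\alpha x$, one has $p_A<q_A$ and $A\in(0,2)$. Then for all $x\in[-1/4,1/4]$, with $A=a+\alpha x$, $$F(K;A,b)=\frac{e^{\pi i/4-\pi iA^2/(2b)}}{\sqrt{2b}}\,F\Bigl(\lfloor 2bK\rfloor;\frac{A}{2b},-\frac1{4b}\Bigr)+R_M(K,A,b)+O(K^{-2}\epsilon+e^{-K}),$$ where $R_M(K,A,b)$ is a linear combination of the constant function $1$ and the following eighteen functions of $x$, in which $E=e^{2\pi i\alpha xK}$ and $G=\frac1{\sqrt{2b}}e^{-\pi iA^2/(2b)}$: - $J(K;M,2bK-\omega_A,b)$, $\;E\,J(K;M,2bK-\omega_{1,A},b)$, - $J(K;p_{1,A},\omega_{1,A},b)$, $\;E\,J(K;p_{1,A},\omega_A,b)$, - $J(K;M,1-\omega_{1,A},b)$, $\;E\,J(K;M,1-\omega_A,b)$, - $\tilde I_{C_7}(K;1-\omega_{1,A},b)$, $\;E\,\tilde I_{C_7}(K;1-\omega_A,b)$, - $\tilde I_{C_7}(K;\omega_{1,A},b)$, $\;E\,\tilde I_{C_7}(K;\omega_A,b)$, - $G$, $\;E\,e^{-2\pi\omega_AK}\,\tilde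 I_{C_0}(K;e^{\pi i/4}(-i\omega_A+2bK),-ib)$, - $E$, $\;E\,e^{-2\pi\omega_AK}\,\tilde I_{C_0}(K;-i\omega_A+2bK,-b)$, - $\delta_{2-p_A}\,e^{2\pi i\alpha x/(2b)}\,G$, $\;\delta_{q_A-K^*-1}\,e^{2\pi i\alpha x(K^*+1)/(2b)}\,G$, - $\delta_{q_A-K^*-2}\,e^{2\pi i\alpha x(K^*+1)/(2b)}\,G$, $\;\delta_{q_A-K^*-2}\,e^{2\pi i\alpha x(K^*+2)/(2b)}\,G$. The nineteen coefficients are $O(1)$, do not depend on $x$, and can all be computed to within $\epsilon/K^2$ using $O(\nu)$ operations on numbers of $O(\nu)$ bits. Precisely, there is one program, independent of all parameters, built from elementary operations (addition, multiplication, logarithm of a positive number, complex exponential, loading a Gaussian rational or $\pi$) and from branching and looping on the sign of a real part, each operation or test counting as one. Its registers hold complex numbers $(m+ni)2^{-B}$ with integers $|m|,|n|\le4^B$, where $B=\lceil A_3\nu\rceil$ with $A_3$ an absolute constant, and each result is rounded down to $B$ binary places. From $K$ and any $B$-bit real approximations $a',b'$ with $|a'-a|,|b'-b|\le2^{-B}$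 and $\lfloor 2b'K\rfloor=\lfloor 2bK\rfloor$, it halts after $O(\nu)$ operations, without overflow, with values within $\epsilon/K^2$ of the coefficients. -/

import Mathlib

namespace TruncTheta

noncomputable section

/-! ### The sums and integrals -/

/-- `F(K,j;a,b) = K⁻ʲ ∑_{k=0}^K kʲ exp(2πiak + 2πibk²)` (with `0⁰ = 1`). -/
def F (K j : ℕ) (a b : ℝ) : ℂ :=
  (1 / (K : ℂ) ^ j) * ∑ k ∈ Finset.range (K + 1),
    (k : ℂ) ^ j * Complex.exp (2 * Real.pi * Complex.I * a * k
      + 2 * Real.pi * Complex.I * b * (k : ℂ) ^ 2)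

/-- The integral `I_C(K,j;a,b) = K⁻ʲ ∫_C tʲ exp(2πiat + 2πibt²) dt` along the straight contour
`C = {u t | 0 ≤ t < T}` that starts at the origin in direction `u`. -/
def IC (u : ℂ) (T : ℝ) (K j : ℕ) (a b : ℂ) : ℂ :=
  (1 / (K : ℂ) ^ j) * ∫ t in (0 : ℝ)..T,
    (u * t) ^ j * Complex.exp (2 * Real.pi * Complex.I * a * (u * t)
      + 2 * Real.pi * Complex.I * b * (u * t) ^ 2) * u

/-- `Ĩ_C(K,j;a,b) = I_C(K,j;ia,-b)` for `C₀ = {t | 0 ≤ t < K}`. -/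
def ItC0 (K j : ℕ) (a b : ℂ) : ℂ := IC 1 K K j (Complex.I * a) (-b)

/-- `Ĩ_C(K,j;a,b) = I_C(K,j;ia,-b)` for `C₇ = {e^{-πi/4} t | 0 ≤ t < √2 K}`. -/
def ItC7 (K j : ℕ) (a b : ℂ) : ℂ :=
  IC (Complex.exp (-(Real.pi * Complex.I / 4))) (Real.sqrt 2 * K) K j (Complex.I * a) (-b)

/-- `J(K,j;M,a,b) = K⁻ʲ ∫_0^K tʲ exp(-2πat - 2πibt²) (1 - exp(-2πMt)) / (exp(2πt) - 1) dt`. -/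
def J (K j : ℕ) (M : ℤ) (a b : ℝ) : ℂ :=
  (1 / (K : ℂ) ^ j) * ∫ t in (0 : ℝ)..K,
    (t : ℂ) ^ j * Complex.exp (-(2 * Real.pi * a * t) - 2 * Real.pi * Complex.I * b * (t : ℂ) ^ 2)
      * ((1 - Complex.exp (-(2 * Real.pi * M * t))) / (Complex.exp (2 * Real.pi * t) - 1))

/-! ### The parameters -/

/-- `ν(K,ε) = log (K/ε)`. -/
def nu (K : ℕ) (ε : ℝ) : ℝ := Real.log (K / ε)

/-- `M(K,ε) = ⌈K³ e^{ν(K,ε)}⌉`. -/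
def MM (K : ℕ) (ε : ℝ) : ℤ := ⌈(K : ℝ) ^ 3 * Real.exp (nu K ε)⌉

/-- `p_a = ⌈a⌉`. -/
def p (a : ℝ) : ℤ := ⌈a⌉

/-- `q_a = ⌊a + 2bK⌋`. -/
def q (K : ℕ) (a b : ℝ) : ℤ := ⌊a + 2 * b * K⌋

/-- `p_{1,a} = q_a - p_a`. -/
def p1 (K : ℕ) (a b : ℝ) : ℤ := q K a b - p a

/-- `ω_a = {a + 2bK}`. -/
def om (K : ℕ) (a b : ℝ) : ℝ := Int.fract (a + 2 * b * K)

/-- `ω_{1,a} = ⌈a⌉ - a`. -/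
def om1 (a : ℝ) : ℝ := (p a : ℝ) - a

/-- `K* = ⌊2bK⌋`. -/
def Kstar (K : ℕ) (b : ℝ) : ℕ := ⌊2 * b * K⌋₊

/-- `δ_n` is `1` for `n = 0` and `0` otherwise. -/
def delta (n : ℤ) : ℂ := if n = 0 then 1 else 0

/-- `e(y) = exp(2πiy)` for real `y`. -/
def e (y : ℝ) : ℂ := Complex.exp (2 * Real.pi * Complex.I * y)

/-- The Gaussian factor `(2b)^{-1/2} exp(-πi A²/(2b))`. -/
def gauss (A b : ℝ) : ℂ :=
  (1 / (Real.sqrt (2 * b) : ℂ)) * Complex.exp (-(Real.pi * Complex.I * (A : ℂ) ^ 2 / (2 * b)))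

/-- The constant function `1` (index `0`) and the eighteen functions (indices `1, …, 18`) of which
the remainder is a linear combination; `A` stands for `a + αx`. -/
def remFun (K : ℕ) (ε α a b x : ℝ) : Fin 19 → ℂ :=
  let A : ℝ := a + α * x
  let M : ℤ := MM K ε
  let w : ℝ := om K A b
  let w1 : ℝ := om1 A
  let Ks : ℕ := Kstar K b
  let E : ℂ := e (α * x * K)
  let D : ℂ := E * (Real.exp (-(2 * Real.pi * w * K)) : ℂ)
  ![1,
    J K 0 M (2 * b * K - w) b,
    E * J K 0 M (2 * b * K - w1) b,
    J K 0 (p1 K A b) w1 b,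
    E * J K 0 (p1 K A b) w b,
    J K 0 M (1 - w1) b,
    E * J K 0 M (1 - w) b,
    ItC7 K 0 ((1 - w1 : ℝ) : ℂ) b,
    E * ItC7 K 0 ((1 - w : ℝ) : ℂ) b,
    ItC7 K 0 (w1 : ℂ) b,
    E * ItC7 K 0 (w : ℂ) b,
    gauss A b,
    D * ItC0 K 0 (Complex.exp (Real.pi * Complex.I / 4) * (-(Complex.I * w) + 2 * b * K))
      (-(Complex.I * b)),
    E,
    D * ItC0 K 0 (-(Complex.I * w) + 2 * b * K) (-(b : ℂ)),
    delta (2 - p A) * (e (α * x / (2 * b)) * gauss A b),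
    delta (q K A b - Ks - 1) * (e (α * x * (Ks + 1) / (2 * b)) * gauss A b),
    delta (q K A b - Ks - 2) * (e (α * x * (Ks + 1) / (2 * b)) * gauss A b),
    delta (q K A b - Ks - 2) * (e (α * x * (Ks + 2) / (2 * b)) * gauss A b)]

/-! ### Finite-precision arithmetic programs with an operation count

A register holds a complex number whose coordinates are binary fixed-point numbers with `B` digits
after and about `B` digits before the binary point, that is, a number of `O(B)` bits. One elementary
operation is an addition, a multiplication, a logarithm of a positive number, a complex exponential,
the loading of a constant (a Gaussian rational or `π`), each rounded down to `B` binary places, or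
a test of the sign of a real part. -/

/-- The complex numbers `(m + ni)/2^B` with integers `|m|, |n| ≤ 4^B`. -/
def IsBits (B : ℕ) (z : ℂ) : Prop :=
  ∃ m n : ℤ, |m| ≤ 4 ^ B ∧ |n| ≤ 4 ^ B ∧ z = ((m : ℂ) + n * Complex.I) / 2 ^ B

/-- Rounding of both coordinates down to a multiple of `2^{-B}`. -/
def roundTo (B : ℕ) (z : ℂ) : ℂ :=
  ((⌊z.re * 2 ^ B⌋ : ℂ) + (⌊z.im * 2 ^ B⌋ : ℂ) * Complex.I) / 2 ^ B

/-- The contents of the registers. -/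
abbrev State := ℕ → ℂ

/-- Elementary operations; `i` and `k` are the registers of the operands. -/
inductive Op where
  | const (x y : ℚ)
  | pi
  | add (i k : ℕ)
  | mul (i k : ℕ)
  | log (i : ℕ)
  | exp (i : ℕ)

/-- Only the logarithm has a condition: its operand is a positive real number. -/
def Op.Defined (s : State) : Op → Prop
  | .log i => (s i).im = 0 ∧ 0 < (s i).re
  | _ => True

/-- The exact result of an operation, before rounding. -/
def Op.value (s : State) : Op → ℂ
  | .const x y => (x : ℂ) + (y : ℂ) * Complex.I
  | .pi => (Real.pi : ℂ)
  | .add i k => s i + s k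
  | .mul i k => s i * s k
  | .log i => (Real.log (s i).re : ℂ)
  | .exp i => Complex.exp (s i)

/-- Programs: assignment of the result of an operation to register `r`, composition, and branching
and iteration on the test `0 ≤ Re (register r)`. -/
inductive Prog where
  | assign (r : ℕ) (o : Op)
  | seq (c d : Prog)
  | ifNonneg (r : ℕ) (c d : Prog)
  | whileNonneg (r : ℕ) (c : Prog)

/-- `Prog.Exec B c s n t`: with `B`-bit arithmetic, the program `c` started in the state `s` halts in
the state `t` after exactly `n` elementary operations. A program that overflows, or takes the
logarithm of something that is not a positive number, has no execution. -/
inductive Prog.Exec (B : ℕ) : Prog → State → ℕ → State → Prop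
  | assign {r : ℕ} {o : Op} {s : State} (hdef : o.Defined s)
      (hbits : IsBits B (roundTo B (o.value s))) :
      Prog.Exec B (.assign r o) s 1 (Function.update s r (roundTo B (o.value s)))
  | seq {c d : Prog} {s t u : State} {m n : ℕ} (hc : Prog.Exec B c s m t)
      (hd : Prog.Exec B d t n u) : Prog.Exec B (.seq c d) s (m + n) u
  | ifTrue {r : ℕ} {c d : Prog} {s t : State} {n : ℕ} (h : 0 ≤ (s r).re)
      (hc : Prog.Exec B c s n t) : Prog.Exec B (.ifNonneg r c d) s (n + 1) t
  | ifFalse {r : ℕ} {c d : Prog} {s t : State} {n : ℕ} (h : (s r).re < 0)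
      (hd : Prog.Exec B d s n t) : Prog.Exec B (.ifNonneg r c d) s (n + 1) t
  | whileStop {r : ℕ} {c : Prog} {s : State} (h : (s r).re < 0) :
      Prog.Exec B (.whileNonneg r c) s 1 s
  | whileStep {r : ℕ} {c : Prog} {s t u : State} {m n : ℕ} (h : 0 ≤ (s r).re)
      (hc : Prog.Exec B c s m t) (hw : Prog.Exec B (.whileNonneg r c) t n u) :
      Prog.Exec B (.whileNonneg r c) s (m + n + 1) u

/-- The initial state: registers `0, 1, 2` hold the three inputs, all others hold `0`. -/
def initState (x y z : ℂ) : State := fun r =>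
  if r = 0 then x else if r = 1 then y else if r = 2 then z else 0

end

end TruncTheta

/-! Poisson summation on `[0,K]`, in trapezoidal form so that both end terms count half, writes the
theta sum as `(1 + κ)/2`, with `κ` its last term, plus the sum over integers `m` of `fres K b (A -
m)`, the integral of `e((A - m)t + bt²)` over `[0,K]`. The phase is stationary at `t = (m -
A)/(2b)`, which lies in `[0,K]` exactly when `p_A ≤ m ≤ q_A`.

For `m` in this window both endpoints are joined to infinity in the direction `e^{πi/4}`, and each
integral is a full Gaussian minus two half-line integrals (`fres_eq_diagInf`, `diagInf_add_neg`).
Completing the square (`gauss_sub`) turns the Gaussians into terms of the dual theta sum. Its range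
`0, …, ⌊2bK⌋` differs from the window by `m = 0`, possibly `m = 1`, and at most two terms at the top
(`sum_saddle_eq`); these give `G` and the functions with `δ`.

For `m` outside the window there is no saddle. Integrating over a triangle (`fres_up`, `fres_down`)
leaves one integral along `C₇` and one along a vertical segment, with decay parameter `w` growing
linearly in the distance to the window. Once `w ≥ 1` the two contours agree up to `K e^{-2πK}`
(`norm_diag_sub_vert_le`), and summing the vertical integrals is a geometric series under the
integral sign, which is `J` (`J_eq_sum`). Single terms decay only like `1/m`; pairing the `j`-th
frequency below the window with the `j`-th above it leaves `O(K/j²)`, so stopping after `M` pairs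
costs `O(K/M)`, within `ε/K²`. All this is `norm_theta_sub_le`. Replacing `a` by `a + αx` only
multiplies the phases by `e(αxK)` and `e(αxm/(2b))`, so the coefficients are free of `x`.

The coefficients are products of constants and unimodular exponentials, computed by a straight-line
program. Errors are tracked as powers of `X = K/ε` times `2⁻ᴮ`, and `B = ⌈60ν⌉` gives `X⁴⁰ ≤ 2ᴮ`.
The one loop finds `2ᴮ` and `2⁻ᴮ` from the rounding behaviour, which makes `⌊2bK⌋` computable. -/

namespace TruncTheta

open Complex Filter Topology MeasureTheory

/-! ### Contour integrals of a quadratic exponential -/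

/-- The entire function `exp(2πi(cz + bz²))`. -/
noncomputable def quadExp (b c : ℝ) (z : ℂ) : ℂ :=
  Complex.exp (2 * Real.pi * Complex.I * (c * z + b * z ^ 2))

lemma differentiable_quadExp (b c : ℝ) : Differentiable ℂ (quadExp b c) := by
  unfold quadExp; fun_prop

lemma continuous_quadExp (b c : ℝ) : Continuous (quadExp b c) :=
  (differentiable_quadExp b c).continuous

/-- With a global primitive every change of contour becomes an identity between differences of
values of `Φ`. -/
lemma exists_primitive_quadExp (b c : ℝ) :
    ∃ Φ : ℂ → ℂ, ∀ z, HasDerivAt Φ (quadExp b c z) z := by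
  obtain ⟨Φ, hΦ⟩ := (differentiable_quadExp b c).isExactOn_univ
  exact ⟨Φ, fun z => hΦ z (Set.mem_univ z)⟩

/-- The integral of `exp(-2πwz - 2πibz²)` along the segment from `0` to `uT`. -/
noncomputable def rayInt (u : ℂ) (T b w : ℝ) : ℂ :=
  IC u T 1 0 (Complex.I * w) (-b)

lemma rayInt_eq (u : ℂ) (T b w : ℝ) : rayInt u T b w = ∫ t in (0 : ℝ)..T,
    Complex.exp (-(2 * Real.pi * w * (u * t)) - 2 * Real.pi * Complex.I * b * (u * t) ^ 2) * u := by
  unfold rayInt IC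
  simp only [pow_zero, div_one, one_mul]
  congr 1
  ext t
  congr 2
  linear_combination (2 * Real.pi * w * (u * t)) * Complex.I_sq

lemma ItC7_eq (K : ℕ) (b w : ℝ) : ItC7 K 0 w b =
    rayInt (Complex.exp (-(Real.pi * Complex.I / 4))) (Real.sqrt 2 * K) b w := by
  simp [ItC7, rayInt, IC]

lemma integral_segment {b c : ℝ} {Φ : ℂ → ℂ} (hΦ : ∀ z, HasDerivAt Φ (quadExp b c z) z)
    (z v : ℂ) (T : ℝ) :
    ∫ t in (0 : ℝ)..T, quadExp b c (z + v * t) * v = Φ (z + v * T) - Φ z := by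
  have h : ∀ t ∈ Set.uIcc (0 : ℝ) T,
      HasDerivAt (fun t : ℝ => Φ (z + v * t)) (quadExp b c (z + v * t) * v) t := by
    intro t _
    have h1 : HasDerivAt (fun t : ℂ => z + v * t) v (t : ℂ) := by
      simpa using ((hasDerivAt_id (t : ℂ)).const_mul v).const_add z
    exact ((hΦ _).comp (t : ℂ) h1).comp_ofReal
  rw [intervalIntegral.integral_eq_sub_of_hasDerivAt h]
  · simp
  · apply Continuous.intervalIntegrable
    have := continuous_quadExp b c
    fun_prop

/-- Expanding the quadratic phase about `s` along `z = s + iut` shifts the linear coefficient to its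
derivative `c + 2bs` at `s`; the factor `i` turns oscillation into decay when this is positive.
`rayInt_down` is the same in the direction `-iu`, for negative derivative. -/
lemma rayInt_up {b c : ℝ} {Φ : ℂ → ℂ} (hΦ : ∀ z, HasDerivAt Φ (quadExp b c z) z)
    (s T : ℝ) (u : ℂ) :
    quadExp b c s * Complex.I * rayInt u T b (c + 2 * b * s)
      = Φ (s + Complex.I * u * T) - Φ s := by
  rw [← integral_segment hΦ, rayInt_eq, ← intervalIntegral.integral_const_mul]
  congr 1
  ext t
  have : quadExp b c (s + Complex.I * u * t) = quadExp b c s * Complex.exp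
      (-(2 * Real.pi * ((c + 2 * b * s : ℝ) : ℂ) * (u * t))
        - 2 * Real.pi * Complex.I * b * (u * t) ^ 2) := by
    unfold quadExp
    rw [← Complex.exp_add]
    congr 1
    push_cast
    linear_combination (2 * Real.pi * (c + 2 * b * s) * (u * t)
      + 2 * Real.pi * Complex.I * b * (u * t) ^ 2) * Complex.I_sq
  rw [this]; ring

lemma rayInt_down {b c : ℝ} {Φ : ℂ → ℂ} (hΦ : ∀ z, HasDerivAt Φ (quadExp b c z) z)
    (s T : ℝ) (u : ℂ) :
    -(quadExp b c s * Complex.I * rayInt u T b (-(c + 2 * b * s)))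
      = Φ (s - Complex.I * u * T) - Φ s := by
  have h0 : (s : ℂ) - Complex.I * u * T = s + (-(Complex.I * u)) * T := by ring
  rw [h0, ← integral_segment hΦ, rayInt_eq, ← intervalIntegral.integral_const_mul,
    ← intervalIntegral.integral_neg]
  congr 1
  ext t
  have : quadExp b c (s + -(Complex.I * u) * t) = quadExp b c s * Complex.exp
      (-(2 * Real.pi * ((-(c + 2 * b * s) : ℝ) : ℂ) * (u * t))
        - 2 * Real.pi * Complex.I * b * (u * t) ^ 2) := by
    unfold quadExp
    rw [← Complex.exp_add]
    congr 1
    push_cast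
    linear_combination (-2 * Real.pi * (c + 2 * b * s) * (u * t)
      + 2 * Real.pi * Complex.I * b * (u * t) ^ 2) * Complex.I_sq
  rw [this]; ring

lemma norm_quadExp (b c : ℝ) (z : ℂ) :
    ‖quadExp b c z‖ = Real.exp (-(2 * Real.pi * (c * z.im + 2 * b * z.re * z.im))) := by
  unfold quadExp
  rw [Complex.norm_exp]
  congr 1
  simp [pow_two]
  ring

lemma norm_quadExp_ofReal (b c s : ℝ) : ‖quadExp b c s‖ = 1 := by simp [norm_quadExp]

/-- The direction `e^{-πi/4}` of `C₇`. -/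
noncomputable def dir7 : ℂ := Complex.exp (-(Real.pi * Complex.I / 4))

lemma dir7_eq : dir7 = (1 - Complex.I) / Real.sqrt 2 := by
  have h2 : (Real.sqrt 2 : ℂ) ≠ 0 := by
    exact_mod_cast (Real.sqrt_pos.2 (by norm_num : (0:ℝ) < 2)).ne'
  have h3 : (Real.sqrt 2 : ℂ) ^ 2 = 2 := by
    exact_mod_cast Real.sq_sqrt (by norm_num : (0:ℝ) ≤ 2)
  unfold dir7
  rw [show -(Real.pi * Complex.I / 4) = (((-(Real.pi / 4) : ℝ)) : ℂ) * Complex.I by push_cast; ring,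
    Complex.exp_mul_I, ← Complex.ofReal_cos, ← Complex.ofReal_sin, Real.cos_neg, Real.sin_neg,
    Real.cos_pi_div_four, Real.sin_pi_div_four]
  push_cast
  field_simp
  rw [h3]; ring

lemma dir7_mul_sqrt_two (T : ℝ) : dir7 * ((Real.sqrt 2 * T : ℝ) : ℂ) = T - Complex.I * T := by
  have h2 : (Real.sqrt 2 : ℂ) ≠ 0 := by
    exact_mod_cast (Real.sqrt_pos.2 (by norm_num : (0:ℝ) < 2)).ne'
  rw [dir7_eq]; push_cast; field_simp

lemma dir7_sq : dir7 ^ 2 = -Complex.I := by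
  have h3 : (Real.sqrt 2 : ℂ) ^ 2 = 2 := by
    exact_mod_cast Real.sq_sqrt (by norm_num : (0:ℝ) ≤ 2)
  rw [dir7_eq, div_pow, h3]
  linear_combination (1 / 2) * Complex.I_sq

lemma norm_dir7 : ‖dir7‖ = 1 := by
  unfold dir7
  rw [show -(Real.pi * Complex.I / 4) = (((-(Real.pi / 4) : ℝ)) : ℂ) * Complex.I by push_cast; ring,
    Complex.norm_exp_ofReal_mul_I]

lemma dir7_re : dir7.re = 1 / Real.sqrt 2 := by
  rw [dir7_eq, Complex.div_ofReal_re]; simp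

/-- `∫_0^K exp(-2πwt - 2πibt²) dt`. -/
noncomputable def vert (K : ℕ) (b w : ℝ) : ℂ := rayInt 1 K b w

/-- `∫_{C₇} exp(-2πwt - 2πibt²) dt`. -/
noncomputable def diag (K : ℕ) (b w : ℝ) : ℂ := rayInt dir7 (Real.sqrt 2 * K) b w

/-- The Fourier integral `∫_0^K exp(2πi(ct + bt²)) dt`. -/
noncomputable def fres (K : ℕ) (b c : ℝ) : ℂ := ∫ t in (0 : ℝ)..K, quadExp b c t

lemma fres_eq {b c : ℝ} {Φ : ℂ → ℂ} (hΦ : ∀ z, HasDerivAt Φ (quadExp b c z) z) (K : ℕ) :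
    fres K b c = Φ K - Φ 0 := by
  have := integral_segment hΦ 0 1 K
  simpa [fres] using this

/-- Integration over the triangle `0, K, K + iK`. -/
lemma fres_up (K : ℕ) (b c : ℝ) : fres K b c
    = Complex.I * diag K b c - quadExp b c K * Complex.I * vert K b (c + 2 * b * K) := by
  obtain ⟨Φ, hΦ⟩ := exists_primitive_quadExp b c
  have h1 := rayInt_up hΦ 0 (Real.sqrt 2 * K) dir7
  have h2 := rayInt_up hΦ K K 1
  rw [mul_assoc Complex.I dir7, dir7_mul_sqrt_two] at h1
  -- The diagonal from `0` and the vertical segment from `K` meet at the corner `K + iK`.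
  have h4 : (0:ℝ) + Complex.I * ((K:ℝ) - Complex.I * (K:ℝ)) = (K : ℂ) + Complex.I * 1 * (K:ℝ) := by
    push_cast; linear_combination -(K:ℂ) * Complex.I_sq
  rw [h4] at h1
  have h5 : quadExp b c (0:ℝ) = 1 := by simp [quadExp]
  rw [h5] at h1
  simp only [mul_zero, add_zero] at h1
  rw [fres_eq hΦ]
  unfold diag vert
  push_cast at h1 h2 ⊢
  linear_combination -h1 + h2

/-- Integration over the triangle `0, K, -iK`. -/
lemma fres_down (K : ℕ) (b c : ℝ) : fres K b c
    = -(Complex.I * vert K b (-c)) + quadExp b c K * Complex.I * diag K b (-(c + 2 * b * K)) := by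
  obtain ⟨Φ, hΦ⟩ := exists_primitive_quadExp b c
  have h1 := rayInt_down hΦ K (Real.sqrt 2 * K) dir7
  have h2 := rayInt_down hΦ 0 K 1
  rw [mul_assoc Complex.I dir7, dir7_mul_sqrt_two] at h1
  have h4 : ((K:ℝ):ℂ) - Complex.I * ((K:ℝ) - Complex.I * (K:ℝ)) = (0:ℝ) - Complex.I * 1 * (K:ℝ) := by
    push_cast; linear_combination (K:ℂ) * Complex.I_sq
  rw [h4] at h1
  have h5 : quadExp b c (0:ℝ) = 1 := by simp [quadExp]
  rw [h5] at h2
  simp only [mul_zero, add_zero] at h2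
  rw [fres_eq hΦ]
  unfold diag vert
  push_cast at h1 h2 ⊢
  linear_combination h1 - h2

/-- On a horizontal line in the closed upper half-plane the modulus `exp(-2π(c + 2b Re z) Im z)`
does not increase to the right, so the left endpoint gives the maximum. -/
lemma norm_integral_horizontal_le {b c : ℝ} (hb : 0 ≤ b) {Φ : ℂ → ℂ}
    (hΦ : ∀ z, HasDerivAt Φ (quadExp b c z) z) (K : ℕ) {z : ℂ} (him : 0 ≤ z.im) :
    ‖Φ (z + K) - Φ z‖ ≤ K * Real.exp (-(2 * Real.pi * (c * z.im + 2 * b * z.re * z.im))) := by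
  have h := integral_segment hΦ z 1 K
  simp only [mul_one, one_mul] at h
  have h' : Φ (z + K) - Φ z = ∫ t in (0:ℝ)..K, quadExp b c (z + t) := by
    rw [h]; push_cast; rfl
  rw [h']
  have := intervalIntegral.norm_integral_le_of_norm_le_const (a := 0) (b := (K:ℝ))
    (f := fun t : ℝ => quadExp b c (z + t))
    (C := Real.exp (-(2 * Real.pi * (c * z.im + 2 * b * z.re * z.im)))) (by
      intro t ht
      rw [Set.uIoc_of_le (by positivity)] at ht
      rw [norm_quadExp]
      apply Real.exp_le_exp.2
      simp only [add_re, ofReal_re, add_im, ofReal_im, add_zero]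
      have : 0 ≤ Real.pi * (b * t * z.im) :=
        mul_nonneg Real.pi_pos.le (mul_nonneg (mul_nonneg hb ht.1.le) him)
      nlinarith)
  simpa [mul_comm] using this

/-- The two contours agree up to an exponentially small term. -/
lemma norm_diag_sub_vert_le {b : ℝ} (hb : 0 ≤ b) (K : ℕ) (w : ℝ) :
    ‖diag K b w - vert K b w‖ ≤ K * Real.exp (-(2 * Real.pi * w * K)) := by
  obtain ⟨Φ, hΦ⟩ := exists_primitive_quadExp b w
  have h1 := rayInt_up hΦ 0 (Real.sqrt 2 * K) dir7
  have h2 := rayInt_up hΦ 0 K 1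
  rw [mul_assoc Complex.I dir7, dir7_mul_sqrt_two] at h1
  have h4 : (0:ℝ) + Complex.I * ((K:ℝ) - Complex.I * (K:ℝ)) = Complex.I * (K:ℂ) + K := by
    push_cast; linear_combination -(K:ℂ) * Complex.I_sq
  have h5 : quadExp b w (0:ℝ) = 1 := by simp [quadExp]
  rw [h4, h5] at h1
  rw [h5] at h2
  simp only [mul_zero, add_zero, one_mul, mul_one, ofReal_zero, zero_add, ofReal_natCast] at h1 h2
  have h3 := norm_integral_horizontal_le hb hΦ K (z := Complex.I * K) (by simp)
  -- Turned by `i`, the two rays end at `K + iK` and `iK`; only the horizontal segment between these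
  -- points separates them.
  have h6 : Φ (Complex.I * K + K) - Φ (Complex.I * K)
      = Complex.I * (diag K b w - vert K b w) := by
    unfold diag vert; linear_combination -h1 + h2
  rw [h6, norm_mul, Complex.norm_I, one_mul] at h3
  refine h3.trans (le_of_eq ?_)
  congr 2
  simp; ring

/-! ### The limit of the diagonal integral -/

/-- `∫_0^∞ exp(-2πwut - 2πbt²) u dt` with `u = e^{-πi/4}`. -/
noncomputable def diagInf (b w : ℝ) : ℂ :=
  ∫ t in Set.Ioi (0 : ℝ), Complex.exp (-(2 * Real.pi * b) * (t:ℂ) ^ 2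
    + -(2 * Real.pi * w * dir7) * t + 0) * dir7

lemma rayInt_dir7 (T b w : ℝ) : rayInt dir7 T b w = ∫ t in (0 : ℝ)..T,
    Complex.exp (-(2 * Real.pi * b) * (t:ℂ) ^ 2 + -(2 * Real.pi * w * dir7) * t + 0) * dir7 := by
  rw [rayInt_eq]
  congr 1
  ext t
  congr 2
  rw [mul_pow, dir7_sq]
  linear_combination (2 * Real.pi * b * (t:ℂ) ^ 2) * Complex.I_sq

lemma integrable_dir7 {b : ℝ} (hb : 0 < b) (w : ℝ) : Integrable (fun t : ℝ =>
    Complex.exp (-(2 * Real.pi * b) * (t:ℂ) ^ 2 + -(2 * Real.pi * w * dir7) * t + 0) * dir7) := by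
  apply Integrable.mul_const
  apply integrable_cexp_quadratic
  have : (0:ℝ) < 2 * Real.pi * b := by positivity
  simpa using this

lemma tendsto_rayInt_dir7 {b : ℝ} (hb : 0 < b) (w : ℝ) :
    Tendsto (fun T => rayInt dir7 T b w) atTop (𝓝 (diagInf b w)) := by
  simp_rw [rayInt_dir7]
  exact intervalIntegral_tendsto_integral_Ioi 0 (integrable_dir7 hb w).integrableOn tendsto_id

lemma norm_dir7_integrand (b w t : ℝ) : ‖Complex.exp (-(2 * Real.pi * b) * (t:ℂ) ^ 2
    + -(2 * Real.pi * w * dir7) * t + 0) * dir7‖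
      = Real.exp (-(2 * Real.pi * b) * t ^ 2 - 2 * Real.pi * w * t / Real.sqrt 2) := by
  rw [norm_mul, norm_dir7, mul_one, Complex.norm_exp]
  congr 1
  have h : (-(2 * Real.pi * b) * (t:ℂ) ^ 2 + -(2 * Real.pi * w * dir7) * t + 0)
      = ((-(2 * Real.pi * b) * t ^ 2 : ℝ) : ℂ) + ((-(2 * Real.pi * w * t) : ℝ) : ℂ) * dir7 := by
    push_cast; ring
  rw [h, Complex.add_re, Complex.ofReal_re, Complex.re_ofReal_mul, dir7_re]
  ring

/-- Beyond `T = √2 K` the inequality `t² ≥ Tt` replaces the Gaussian by an exponential of rate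
`2πbT`, and `2πbT² = 2πK · 2bK ≥ 2πK`. -/
lemma norm_diagInf_sub_le {b w : ℝ} (hw : 0 ≤ w) (K : ℕ) (hK : 1 ≤ 2 * b * K) :
    ‖diagInf b w - diag K b w‖ ≤ Real.exp (-(2 * Real.pi * K)) := by
  have hKp : (0:ℝ) < K := by
    rcases Nat.eq_zero_or_pos K with h | h
    · subst h; norm_num at hK
    · exact_mod_cast h
  have hb : 0 < b := by
    by_contra h
    push Not at h
    nlinarith
  set T : ℝ := Real.sqrt 2 * K with hT
  have hs : (1:ℝ) ≤ Real.sqrt 2 := by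
    rw [Real.one_le_sqrt]; norm_num
  have hTK : (K:ℝ) ≤ T := by rw [hT]; nlinarith
  have hTp : 0 < T := hKp.trans_le hTK
  have hint := integrable_dir7 hb w
  have h1 : diagInf b w - diag K b w = ∫ t in Set.Ioi T, Complex.exp (-(2 * Real.pi * b) * (t:ℂ) ^ 2
    + -(2 * Real.pi * w * dir7) * t + 0) * dir7 := by
    unfold diagInf diag
    rw [rayInt_dir7, ← intervalIntegral.integral_Ioi_sub_Ioi hint.integrableOn hTp.le]
    ring
  rw [h1]
  set r : ℝ := 2 * Real.pi * b * T with hr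
  have hrp : 0 < r := by positivity
  have hexp : IntegrableOn (fun t : ℝ => Real.exp (-r * t)) (Set.Ioi T) :=
    integrableOn_exp_mul_Ioi (by linarith) T
  refine (norm_integral_le_of_norm_le hexp ?_).trans ?_
  · filter_upwards [ae_restrict_mem measurableSet_Ioi] with t ht
    rw [norm_dir7_integrand]
    apply Real.exp_le_exp.2
    have ht' : T < t := ht
    have : 0 ≤ 2 * Real.pi * w * t / Real.sqrt 2 := by
      have : 0 < t := hTp.trans ht'
      positivity
    have h3 : r * t ≤ 2 * Real.pi * b * t ^ 2 := by
      rw [hr]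
      have : 0 ≤ 2 * Real.pi * b * t := by
        have : 0 < t := hTp.trans ht'
        positivity
      nlinarith
    linarith
  · rw [integral_exp_mul_Ioi (by linarith)]
    have hT2 : T ^ 2 = 2 * K ^ 2 := by
      rw [hT, mul_pow, Real.sq_sqrt (by norm_num)]
    have h4 : 2 * Real.pi * K ≤ r * T := by
      rw [hr]
      have : 2 * Real.pi * b * T * T = 2 * Real.pi * K * (2 * b * K) := by
        linear_combination (2 * Real.pi * b) * hT2
      rw [this]
      have : 0 < 2 * Real.pi * K := by positivity
      nlinarith
    have h5 : 1 ≤ r := by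
      rw [hr]
      have : 3 ≤ Real.pi := Real.pi_gt_three.le
      have h6 : 2 * b * K ≤ 2 * b * T := by nlinarith
      have h7 : 1 ≤ 2 * b * T := by linarith
      nlinarith
    rw [neg_div_neg_eq]
    calc Real.exp (-r * T) / r ≤ Real.exp (-r * T) := by
          exact div_le_self (Real.exp_pos _).le h5
      _ ≤ _ := Real.exp_le_exp.2 (by linarith)

/-- The stationary phase term. -/
lemma diagInf_add_neg {b : ℝ} (hb : 0 < b) (w : ℝ) :
    Complex.I * (diagInf b w + diagInf b (-w))
      = Complex.exp (Real.pi * Complex.I / 4) * gauss w b := by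
  have hint := integrable_dir7 hb w
  -- The reflection `t ↦ -t` changes the sign of `w`, so the two half-lines form one complete
  -- Gaussian integral.
  have h1 : diagInf b (-w) = ∫ t in Set.Iic (0:ℝ), Complex.exp (-(2 * Real.pi * b) * (t:ℂ) ^ 2
    + -(2 * Real.pi * w * dir7) * t + 0) * dir7 := by
    have := integral_comp_neg_Iic (0:ℝ) (fun t : ℝ => Complex.exp (-(2 * Real.pi * b) * (t:ℂ) ^ 2
      + -(2 * Real.pi * ((-w : ℝ) : ℂ) * dir7) * t + 0) * dir7)
    rw [neg_zero] at this
    unfold diagInf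
    rw [← this]
    congr 1
    ext t
    congr 2
    push_cast; ring
  have h2 : diagInf b w + diagInf b (-w) = ∫ t : ℝ, Complex.exp (-(2 * Real.pi * b) * (t:ℂ) ^ 2
    + -(2 * Real.pi * w * dir7) * t + 0) * dir7 := by
    rw [h1, add_comm]
    unfold diagInf
    exact intervalIntegral.integral_Iic_add_Ioi hint.integrableOn hint.integrableOn
  have hbc : (b:ℂ) ≠ 0 := by exact_mod_cast hb.ne'
  have hpi : (Real.pi : ℂ) ≠ 0 := by exact_mod_cast Real.pi_ne_zero
  have hpos : (0:ℝ) < 2 * Real.pi * b := by positivity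
  rw [h2, MeasureTheory.integral_mul_const, integral_cexp_quadratic (by simpa using hpos)]
  have h3 : ((Real.pi : ℂ) / -(-(2 * Real.pi * b))) ^ (1 / 2 : ℂ) = 1 / (Real.sqrt (2 * b) : ℂ) := by
    have : (Real.pi : ℂ) / -(-(2 * Real.pi * b)) = ((1 / (2 * b) : ℝ) : ℂ) := by
      push_cast; field_simp
    rw [this, show (1 / 2 : ℂ) = ((1 / 2 : ℝ) : ℂ) by push_cast; rfl,
      ← Complex.ofReal_cpow (by positivity), ← Real.sqrt_eq_rpow, Real.sqrt_div (by norm_num)]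
    simp
  have h4 : (0:ℂ) - (-(2 * Real.pi * w * dir7)) ^ 2 / (4 * (-(2 * Real.pi * b)))
      = -(Real.pi * Complex.I * (w:ℂ) ^ 2 / (2 * b)) := by
    rw [neg_sq, mul_pow, dir7_sq]
    field_simp
    ring
  have h5 : Complex.I * dir7 = Complex.exp (Real.pi * Complex.I / 4) := by
    have : Complex.exp (Real.pi / 2 * Complex.I) = Complex.I := Complex.exp_pi_div_two_mul_I
    rw [dir7]
    nth_rewrite 1 [← this]
    rw [← Complex.exp_add]
    congr 1; ring
  rw [h3, h4, gauss, ← h5]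
  ring

/-- Integration over the unbounded strip in the direction `e^{πi/4}` between `0` and `K`. -/
lemma fres_eq_diagInf {b : ℝ} (hb : 0 < b) (K : ℕ) (c : ℝ) : fres K b c
    = Complex.I * diagInf b c - quadExp b c K * Complex.I * diagInf b (c + 2 * b * K) := by
  obtain ⟨Φ, hΦ⟩ := exists_primitive_quadExp b c
  have h1 (T : ℝ) : Complex.I * rayInt dir7 (Real.sqrt 2 * T) b c = Φ (T + Complex.I * T) - Φ 0 := by
    have h1 := rayInt_up hΦ 0 (Real.sqrt 2 * T) dir7
    rw [mul_assoc Complex.I dir7, dir7_mul_sqrt_two] at h1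
    have h5 : quadExp b c (0:ℝ) = 1 := by simp [quadExp]
    have h4 : (0:ℝ) + Complex.I * ((T:ℂ) - Complex.I * T) = T + Complex.I * T := by
      push_cast; linear_combination -(T:ℂ) * Complex.I_sq
    rw [h4, h5] at h1
    simpa using h1
  have h2 (T : ℝ) : quadExp b c K * Complex.I * rayInt dir7 (Real.sqrt 2 * T) b (c + 2 * b * K)
      = Φ (T + Complex.I * T + K) - Φ K := by
    have h1 := rayInt_up hΦ K (Real.sqrt 2 * T) dir7
    rw [mul_assoc Complex.I dir7, dir7_mul_sqrt_two] at h1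
    have h4 : (K:ℝ) + Complex.I * ((T:ℂ) - Complex.I * T) = T + Complex.I * T + K := by
      push_cast; linear_combination -(T:ℂ) * Complex.I_sq
    rw [h4] at h1
    simpa using h1
  have hs : Tendsto (fun T : ℝ => Real.sqrt 2 * T) atTop atTop :=
    tendsto_id.const_mul_atTop (Real.sqrt_pos.2 (by norm_num))
  have l1 := ((tendsto_rayInt_dir7 hb c).comp hs).const_mul Complex.I
  have l2 := ((tendsto_rayInt_dir7 hb (c + 2 * b * K)).comp hs).const_mul
    (quadExp b c K * Complex.I)
  -- The cap of the strip, from `T + iT` to `T + iT + K`, contributes at most `K e^{-T}` once `c +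
  -- 2bT ≥ 1`.
  have l3 : Tendsto (fun T : ℝ => Φ (T + Complex.I * T + K) - Φ (T + Complex.I * T)) atTop (𝓝 0) := by
    have hbnd : Tendsto (fun T : ℝ => (K:ℝ) * Real.exp (-T)) atTop (𝓝 0) := by
      simpa using (Real.tendsto_exp_neg_atTop_nhds_zero).const_mul (K:ℝ)
    refine squeeze_zero_norm' ?_ hbnd
    filter_upwards [eventually_ge_atTop ((|c| + 1) / (2 * b)), eventually_ge_atTop 0] with T hT hT0
    refine (norm_integral_horizontal_le hb.le hΦ K (z := T + Complex.I * T)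
      (by simpa using hT0)).trans ?_
    gcongr
    simp only [add_re, ofReal_re, add_im, ofReal_im, mul_re, mul_im, I_re, I_im]
    ring_nf
    rw [div_le_iff₀ (by positivity)] at hT
    have hc := neg_abs_le c
    have h6 : 1 ≤ c + 2 * b * T := by linarith
    have h7 : T * 1 ≤ T * (c + 2 * b * T) := mul_le_mul_of_nonneg_left h6 hT0
    have h8 : 1 * (T * (c + 2 * b * T)) ≤ (2 * Real.pi) * (T * (c + 2 * b * T)) :=
      mul_le_mul_of_nonneg_right (by linarith [Real.pi_gt_three]) (by linarith)
    nlinarith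
  have l4 := (l1.sub l2).add l3
  rw [add_zero] at l4
  refine tendsto_nhds_unique ?_ l4
  have : (fun T : ℝ => (Complex.I * ((fun T => rayInt dir7 T b c) ∘ fun T : ℝ => Real.sqrt 2 * T) T
      - quadExp b c K * Complex.I *
        ((fun T => rayInt dir7 T b (c + 2 * b * K)) ∘ fun T : ℝ => Real.sqrt 2 * T) T)
      + (Φ (T + Complex.I * T + K) - Φ (T + Complex.I * T))) = fun _ => fres K b c := by
    ext T
    simp only [Function.comp]
    rw [h1, h2, fres_eq hΦ]
    ring
  rw [this]
  exact tendsto_const_nhds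

/-! ### Bounds for the vertical integral -/

lemma vert_eq (K : ℕ) (b w : ℝ) : vert K b w = ∫ t in (0 : ℝ)..K,
    Complex.exp (-(2 * Real.pi * w * t) - 2 * Real.pi * Complex.I * b * (t:ℂ) ^ 2) := by
  simp [vert, rayInt_eq]

lemma vert_integrand_eq (b w t : ℝ) :
    Complex.exp (-(2 * Real.pi * w * t) - 2 * Real.pi * Complex.I * b * (t:ℂ) ^ 2)
      = (Real.exp (-(2 * Real.pi * w) * t) : ℂ) *
        Complex.exp (((-(2 * Real.pi * b * t ^ 2) : ℝ) : ℂ) * Complex.I) := by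
  rw [Complex.ofReal_exp, ← Complex.exp_add]
  congr 1; push_cast; ring

lemma integral_exp_neg_mul (K : ℕ) {r : ℝ} (hr : r ≠ 0) :
    ∫ t in (0:ℝ)..K, Real.exp (-r * t) = (1 - Real.exp (-r * K)) / r := by
  rw [intervalIntegral.integral_comp_mul_left (fun t => Real.exp t) (neg_ne_zero.2 hr)]
  rw [integral_exp]
  simp; field_simp; ring

lemma norm_vert_le (K : ℕ) (b : ℝ) {w : ℝ} (hw : 0 < w) :
    ‖vert K b w‖ ≤ 1 / (2 * Real.pi * w) := by
  have hr : 0 < 2 * Real.pi * w := by positivity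
  rw [vert_eq]
  refine (intervalIntegral.norm_integral_le_of_norm_le (by positivity) (g := fun t =>
    Real.exp (-(2 * Real.pi * w) * t)) ?_ (by apply Continuous.intervalIntegrable; fun_prop)).trans ?_
  · refine Eventually.of_forall fun t _ => ?_
    rw [vert_integrand_eq, norm_mul, Complex.norm_exp_ofReal_mul_I, mul_one, Complex.norm_real,
      Real.norm_eq_abs, abs_of_pos (Real.exp_pos _)]
  · rw [integral_exp_neg_mul K hr.ne']
    gcongr
    linarith [Real.exp_pos (-(2 * Real.pi * w) * K)]

/-- The oscillating factor is common and `e^{-2πwt}` decreases in `w`, so the modulus of the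
difference is again a difference of exponentials, integrated exactly. The cancellation gained here
is what makes the paired Poisson terms summable. -/
lemma norm_vert_sub_vert_le (K : ℕ) (b : ℝ) {w w' : ℝ} (hw : 0 < w) (hww : w ≤ w') :
    ‖vert K b w - vert K b w'‖ ≤ 1 / (2 * Real.pi * w) - 1 / (2 * Real.pi * w') := by
  have hw' : 0 < w' := hw.trans_le hww
  have hr : 0 < 2 * Real.pi * w := by positivity
  have hr' : 0 < 2 * Real.pi * w' := by positivity
  have hrr : 2 * Real.pi * w ≤ 2 * Real.pi * w' := by
    have := Real.pi_pos; gcongr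
  rw [vert_eq, vert_eq, ← intervalIntegral.integral_sub
    (by apply Continuous.intervalIntegrable; fun_prop)
    (by apply Continuous.intervalIntegrable; fun_prop)]
  refine (intervalIntegral.norm_integral_le_of_norm_le (by positivity) (g := fun t =>
    Real.exp (-(2 * Real.pi * w) * t) - Real.exp (-(2 * Real.pi * w') * t)) ?_
      (by apply Continuous.intervalIntegrable; fun_prop)).trans ?_
  · refine Eventually.of_forall fun t ht => ?_
    rw [vert_integrand_eq, vert_integrand_eq, ← sub_mul, norm_mul, Complex.norm_exp_ofReal_mul_I,
      mul_one, ← Complex.ofReal_sub, Complex.norm_real, Real.norm_eq_abs, abs_of_nonneg]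
    rw [sub_nonneg]
    apply Real.exp_le_exp.2
    have := ht.1
    nlinarith
  · rw [intervalIntegral.integral_sub (by apply Continuous.intervalIntegrable; fun_prop)
      (by apply Continuous.intervalIntegrable; fun_prop), integral_exp_neg_mul K hr.ne',
      integral_exp_neg_mul K hr'.ne', sub_div, sub_div]
    have : Real.exp (-(2 * Real.pi * w') * K) / (2 * Real.pi * w')
        ≤ Real.exp (-(2 * Real.pi * w) * K) / (2 * Real.pi * w) := by
      gcongr
    linarith

/-- The cost `K e^{-2πwK}` of moving to the vertical contour is itself at most `1/(2πw)`. -/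
lemma norm_diag_le {b : ℝ} (hb : 0 ≤ b) (K : ℕ) {w : ℝ} (hw : 0 < w) :
    ‖diag K b w‖ ≤ 1 / (Real.pi * w) := by
  have hr : 0 < 2 * Real.pi * w := by positivity
  have h1 := norm_vert_le K b hw
  have h2 := norm_diag_sub_vert_le hb K w
  have h3 : K * Real.exp (-(2 * Real.pi * w * K)) ≤ 1 / (2 * Real.pi * w) := by
    rw [Real.exp_neg, ← div_eq_mul_inv, div_le_div_iff₀ (Real.exp_pos _) hr, one_mul]
    have := Real.add_one_le_exp (2 * Real.pi * w * K)
    linarith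
  have h4 : ‖diag K b w‖ ≤ ‖diag K b w - vert K b w‖ + ‖vert K b w‖ := by
    simpa using norm_add_le (diag K b w - vert K b w) (vert K b w)
  have h5 : 1 / (Real.pi * w) = 1 / (2 * Real.pi * w) + 1 / (2 * Real.pi * w) := by
    have := Real.pi_pos
    field_simp; norm_num
  linarith

/-! ### The geometric sum of vertical integrals -/

/-- With `y = e^{-2πt}` the kernel of `J` is `(1 - yᴹ)/(y⁻¹ - 1) = y + ⋯ + yᴹ`. -/
lemma J_eq_sum (K M : ℕ) (w b : ℝ) : J K 0 M w b = ∑ j ∈ Finset.range M, vert K b (w + (j + 1)) := by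
  simp_rw [vert_eq]
  rw [← intervalIntegral.integral_finsetSum
    (fun i _ => by apply Continuous.intervalIntegrable; fun_prop)]
  unfold J
  simp only [pow_zero, div_one, one_mul]
  apply intervalIntegral.integral_congr_ae
  refine Eventually.of_forall fun t ht => ?_
  -- The half-open interval omits `t = 0`, where the kernel has a removable singularity.
  rw [Set.uIoc_of_le (by positivity)] at ht
  have ht0 := ht.1
  set y : ℂ := Complex.exp (-(2 * Real.pi * t)) with hy
  have hy1 : y ≠ 1 := by
    intro h
    have : Real.exp (-(2 * Real.pi * t)) = 1 := by
      have : ((Real.exp (-(2 * Real.pi * t)) : ℝ) : ℂ) = 1 := by rw [← h, hy]; push_cast; rfl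
      exact_mod_cast this
    rw [Real.exp_eq_one_iff] at this
    have h2 : 0 < 2 * Real.pi * t := by have := Real.pi_pos; positivity
    linarith
  have hy0 : y ≠ 0 := Complex.exp_ne_zero _
  have h1 : Complex.exp (2 * Real.pi * t) = y⁻¹ := by rw [hy, ← Complex.exp_neg, neg_neg]
  have h2 : Complex.exp (-(2 * Real.pi * ((M:ℤ):ℂ) * t)) = y ^ M := by
    rw [hy, ← Complex.exp_nat_mul]; congr 1; push_cast; ring
  have h3 (j : ℕ) : Complex.exp (-(2 * Real.pi * ((w + (j + 1) : ℝ) : ℂ) * t)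
      - 2 * Real.pi * Complex.I * b * (t:ℂ) ^ 2)
      = Complex.exp (-(2 * Real.pi * w * t) - 2 * Real.pi * Complex.I * b * (t:ℂ) ^ 2)
        * (y * y ^ j) := by
    rw [← pow_succ', hy, ← Complex.exp_nat_mul, ← Complex.exp_add]; congr 1; push_cast; ring
  simp_rw [h3]
  rw [h1, h2, ← Finset.mul_sum, ← Finset.mul_sum, geom_sum_eq hy1]
  congr 1
  have : y - 1 ≠ 0 := sub_ne_zero.2 hy1
  have h5 : 1 - y ≠ 0 := sub_ne_zero.2 (Ne.symm hy1)
  have : y⁻¹ - 1 = (1 - y) / y := by field_simp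
  rw [this, ← neg_sub 1 y, ← neg_sub 1 (y ^ M)]
  field_simp

/-! ### Poisson summation on a finite interval -/

lemma eval_bernoulli_two (t : ℝ) :
    (Polynomial.map (algebraMap ℚ ℝ) (Polynomial.bernoulli (2 * 1))).eval t = t ^ 2 - t + 1 / 6 := by
  simp [Polynomial.bernoulli, Finset.sum_range_succ, bernoulli_eq_bernoulli'_of_ne_one]
  ring

lemma hasSum_cos_div_sq {t : ℝ} (ht : t ∈ Set.Icc (0:ℝ) 1) :
    HasSum (fun n : ℕ => 1 / (n:ℝ) ^ 2 * Real.cos (2 * Real.pi * n * t))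
      (Real.pi ^ 2 * (t ^ 2 - t + 1 / 6)) := by
  have h := hasSum_one_div_nat_pow_mul_cos one_ne_zero ht
  rw [eval_bernoulli_two] at h
  convert h using 1
  norm_num
  ring

/-- The cosine coefficients of a twice continuously differentiable function on `[0,1]` sum to the
trapezoidal correction. -/
lemma hasSum_integral_cos {g g' g'' : ℝ → ℂ} (hg : ∀ t, HasDerivAt g (g' t) t)
    (hg' : ∀ t, HasDerivAt g' (g'' t) t) (hc : Continuous g'') :
    HasSum (fun n : ℕ => ∫ t in (0:ℝ)..1, g t * ((2 * Real.cos (2 * Real.pi * (n + 1) * t) : ℝ) : ℂ))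
      ((g 0 + g 1) / 2 - ∫ t in (0:ℝ)..1, g t) := by
  have hgc : Continuous g := continuous_iff_continuousAt.2 fun t => (hg t).continuousAt
  have hgc' : Continuous g' := continuous_iff_continuousAt.2 fun t => (hg' t).continuousAt
  -- Two integrations by parts replace the divergent cosine series by this absolutely convergent
  -- one. Its term `n = 0` is zero because `1/0 = 0`.
  let c : ℕ → ℝ → ℝ := fun n t => 1 / (n:ℝ) ^ 2 * Real.cos (2 * Real.pi * n * t)
  let B : ℝ → ℝ := fun t => Real.pi ^ 2 * (t ^ 2 - t + 1 / 6)
  have hcB : ∀ t ∈ Set.Icc (0:ℝ) 1, HasSum (fun n => (c n t : ℂ)) (B t : ℂ) := fun t ht =>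
    Complex.hasSum_ofReal.2 (hasSum_cos_div_sq ht)
  have hint : HasSum (fun n => ∫ t in (0:ℝ)..1, g'' t * (c n t : ℂ))
      (∫ t in (0:ℝ)..1, g'' t * (B t : ℂ)) := by
    refine intervalIntegral.hasSum_integral_of_dominated_convergence
      (F := fun (n : ℕ) (t : ℝ) => g'' t * (c n t : ℂ))
      (fun n t => ‖g'' t‖ * (1 / (n:ℝ) ^ 2)) ?_ ?_ ?_ ?_ ?_
    · intro n
      apply Continuous.aestronglyMeasurable
      fun_prop
    · intro n
      refine Eventually.of_forall fun t _ => ?_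
      rw [norm_mul, Complex.norm_real, Real.norm_eq_abs, abs_mul]
      gcongr
      rw [abs_of_nonneg (by positivity)]
      exact mul_le_of_le_one_right (by positivity) (Real.abs_cos_le_one _)
    · refine Eventually.of_forall fun t _ => ?_
      exact (Real.summable_one_div_nat_pow.2 one_lt_two).mul_left _
    · apply Continuous.intervalIntegrable
      simp_rw [tsum_mul_left]
      fun_prop
    · refine Eventually.of_forall fun t ht => ?_
      rw [Set.uIoc_of_le zero_le_one] at ht
      exact (hcB t ⟨ht.1.le, ht.2⟩).mul_left _
  have hsum := ((((hcB 1 ⟨zero_le_one, le_rfl⟩).mul_left (g' 1)).sub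
    ((hcB 0 ⟨le_rfl, zero_le_one⟩).mul_left (g' 0))).sub hint).mul_left
      ((1 / (2 * Real.pi ^ 2) : ℝ) : ℂ)
  have hpi : (Real.pi : ℂ) ≠ 0 := by exact_mod_cast Real.pi_ne_zero
  -- the value of the sum
  have hval : ((1 / (2 * Real.pi ^ 2) : ℝ) : ℂ) * (g' 1 * (B 1 : ℂ) - g' 0 * (B 0 : ℂ)
      - ∫ t in (0:ℝ)..1, g'' t * (B t : ℂ)) = (g 0 + g 1) / 2 - ∫ t in (0:ℝ)..1, g t := by
    -- Both integrations by parts in one primitive, using `B'/(2π²) = t - 1/2`; the values `±1/2` at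
    -- the ends produce the trapezoidal mean.
    have hd : ∀ t ∈ Set.uIcc (0:ℝ) 1, HasDerivAt (fun t : ℝ => g t * ((t - 1 / 2 : ℝ) : ℂ)
        - ((1 / (2 * Real.pi ^ 2) : ℝ) : ℂ) * (g' t * (B t : ℂ)))
        (g t - ((1 / (2 * Real.pi ^ 2) : ℝ) : ℂ) * (g'' t * (B t : ℂ))) t := by
      intro t _
      have h1 : HasDerivAt (fun t : ℝ => ((t - 1 / 2 : ℝ) : ℂ)) ((1:ℝ):ℂ) t :=
        ((hasDerivAt_id t).sub_const (1 / 2)).ofReal_comp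
      have h2 : HasDerivAt (fun t : ℝ => (B t : ℂ)) ((Real.pi ^ 2 * (2 * t - 1) : ℝ) : ℂ) t := by
        have : HasDerivAt B (Real.pi ^ 2 * (2 * t - 1)) t := by
          have := (((hasDerivAt_pow 2 t).sub (hasDerivAt_id t)).add_const (1 / 6)).const_mul
            (Real.pi ^ 2)
          convert! this using 1
          norm_num
        exact this.ofReal_comp
      convert! ((hg t).mul h1).sub (((hg' t).mul h2).const_mul
        ((1 / (2 * Real.pi ^ 2) : ℝ) : ℂ)) using 1
      push_cast
      field_simp
      ring
    have h := intervalIntegral.integral_eq_sub_of_hasDerivAt hd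
      (by apply Continuous.intervalIntegrable; fun_prop)
    rw [intervalIntegral.integral_sub (by apply Continuous.intervalIntegrable; fun_prop)
      (by apply Continuous.intervalIntegrable; fun_prop),
      intervalIntegral.integral_const_mul] at h
    simp only [B] at h ⊢
    push_cast at h ⊢
    linear_combination h
  rw [hval] at hsum
  -- the terms of the sum
  have hterm0 : ((1 / (2 * Real.pi ^ 2) : ℝ) : ℂ) * (g' 1 * (c 0 1 : ℂ) - g' 0 * (c 0 0 : ℂ)
      - ∫ t in (0:ℝ)..1, g'' t * (c 0 t : ℂ)) = 0 := by
    simp [c]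
  have hterm (n : ℕ) : ((1 / (2 * Real.pi ^ 2) : ℝ) : ℂ) *
      (g' 1 * (c (n + 1) 1 : ℂ) - g' 0 * (c (n + 1) 0 : ℂ)
      - ∫ t in (0:ℝ)..1, g'' t * (c (n + 1) t : ℂ))
      = ∫ t in (0:ℝ)..1, g t * ((2 * Real.cos (2 * Real.pi * (n + 1) * t) : ℝ) : ℂ) := by
    have hn : ((n:ℂ) + 1) ≠ 0 := by exact_mod_cast Nat.succ_ne_zero n
    have hd : ∀ t ∈ Set.uIcc (0:ℝ) 1, HasDerivAt (fun t : ℝ =>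
        g t * ((1 / (Real.pi * (n + 1)) * Real.sin (2 * Real.pi * (n + 1) * t) : ℝ) : ℂ)
        + ((1 / (2 * Real.pi ^ 2) : ℝ) : ℂ) * (g' t * (c (n + 1) t : ℂ)))
        (g t * ((2 * Real.cos (2 * Real.pi * (n + 1) * t) : ℝ) : ℂ)
          + ((1 / (2 * Real.pi ^ 2) : ℝ) : ℂ) * (g'' t * (c (n + 1) t : ℂ))) t := by
      intro t _
      have h0 : HasDerivAt (fun t : ℝ => 2 * Real.pi * (n + 1) * t) (2 * Real.pi * (n + 1)) t := by
        simpa using (hasDerivAt_id t).const_mul (2 * Real.pi * (n + 1))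
      have h1 := ((h0.sin).const_mul (1 / (Real.pi * (n + 1)))).ofReal_comp
      have h2 : HasDerivAt (fun t : ℝ => (c (n + 1) t : ℂ))
          ((1 / ((n:ℝ) + 1) ^ 2 * (-Real.sin (2 * Real.pi * (n + 1) * t) * (2 * Real.pi * (n + 1)))
            : ℝ) : ℂ) t := by
        have := ((h0.cos).const_mul (1 / ((n:ℝ) + 1) ^ 2)).ofReal_comp
        simpa [c] using this
      convert! ((hg t).mul h1).add (((hg' t).mul h2).const_mul
        ((1 / (2 * Real.pi ^ 2) : ℝ) : ℂ)) using 1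
      push_cast
      field_simp
      ring
    have h := intervalIntegral.integral_eq_sub_of_hasDerivAt hd
      (by apply Continuous.intervalIntegrable; fun_prop)
    rw [intervalIntegral.integral_add (by apply Continuous.intervalIntegrable; fun_prop)
      (by apply Continuous.intervalIntegrable; fun_prop),
      intervalIntegral.integral_const_mul] at h
    have hs : Real.sin (2 * Real.pi * (n + 1)) = 0 := by
      have := Real.sin_nat_mul_pi (2 * (n + 1))
      rw [← this]; congr 1; push_cast; ring
    simp only [mul_one, hs, mul_zero, Real.sin_zero, ofReal_zero, zero_add] at h
    linear_combination -h
  -- The vanishing term `n = 0` is dropped, so that frequencies start at `1`.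
  have hfin := (hasSum_nat_add_iff' 1).2 hsum
  simp only [Finset.sum_range_one] at hfin
  rw [hterm0, sub_zero] at hfin
  simpa only [hterm] using hfin

lemma hasDerivAt_quadExp (b c t : ℝ) : HasDerivAt (fun t : ℝ => quadExp b c t)
    (2 * Real.pi * Complex.I * (c + 2 * b * t) * quadExp b c t) t := by
  have h : HasDerivAt (quadExp b c) (2 * Real.pi * Complex.I * (c + 2 * b * t) * quadExp b c t)
      (t : ℂ) := by
    have h0 : HasDerivAt (fun z : ℂ => 2 * Real.pi * Complex.I * (c * z + b * z ^ 2))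
        (2 * Real.pi * Complex.I * (c + 2 * b * t)) (t : ℂ) := by
      have := ((((hasDerivAt_id (t:ℂ)).const_mul (c:ℂ)).add
        ((hasDerivAt_pow 2 (t:ℂ)).const_mul (b:ℂ))).const_mul (2 * Real.pi * Complex.I))
      convert! this using 1
      norm_num
      ring
    have := h0.cexp
    unfold quadExp
    convert! this using 1
    ring
  exact h.comp_ofReal

lemma quadExp_add_int (b c : ℝ) (m : ℤ) (t : ℂ) :
    quadExp b (c + m) t = quadExp b c t * Complex.exp (2 * Real.pi * Complex.I * (m * t)) := by
  unfold quadExp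
  rw [← Complex.exp_add]; congr 1; push_cast; ring

lemma quadExp_add_int_natCast (b c : ℝ) (m : ℤ) (k : ℕ) :
    quadExp b (c + m) k = quadExp b c k := by
  rw [quadExp_add_int]
  have : Complex.exp (2 * Real.pi * Complex.I * (m * k)) = 1 := by
    rw [Complex.exp_eq_one_iff]
    exact ⟨m * k, by push_cast; ring⟩
  rw [this, mul_one]

lemma fres_eq_sum (K : ℕ) (b c : ℝ) :
    fres K b c = ∑ k ∈ Finset.range K, ∫ t in (0:ℝ)..1, quadExp b c ((t + k : ℝ) : ℂ) := by
  have hc := continuous_quadExp b c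
  have h := intervalIntegral.sum_integral_adjacent_intervals (f := fun t : ℝ => quadExp b c t)
    (a := fun k : ℕ => (k:ℝ)) (n := K) (μ := volume)
    (fun k _ => by apply Continuous.intervalIntegrable; fun_prop)
  simp only [Nat.cast_zero] at h
  unfold fres
  rw [← h]
  refine Finset.sum_congr rfl fun k _ => ?_
  have := intervalIntegral.integral_comp_add_right (a := 0) (b := 1)
    (fun t : ℝ => quadExp b c t) (k:ℝ)
  rw [this]
  push_cast
  rw [zero_add, add_comm]

/-- The integer `k` disappears from `e(±m(t + k))`, so on each unit interval the frequencies `m` and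
`-m` together give the kernel `2 cos(2πmt)`. -/
lemma quadExp_add_sub (b c : ℝ) (m k : ℕ) (t : ℝ) :
    quadExp b (c + m) ((t + k : ℝ) : ℂ) + quadExp b (c - m) ((t + k : ℝ) : ℂ)
      = quadExp b c ((t + k : ℝ) : ℂ) * ((2 * Real.cos (2 * Real.pi * m * t) : ℝ) : ℂ) := by
  have h1 (j : ℤ) : Complex.exp (2 * Real.pi * Complex.I * (j * ((t + k : ℝ) : ℂ)))
      = Complex.exp (((2 * Real.pi * j * t : ℝ) : ℂ) * Complex.I) := by
    rw [Complex.exp_eq_exp_iff_exists_int]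
    exact ⟨j * k, by push_cast; ring⟩
  have h2 := quadExp_add_int b c m ((t + k : ℝ) : ℂ)
  have h3 := quadExp_add_int b c (-m) ((t + k : ℝ) : ℂ)
  rw [h1] at h2 h3
  have h4 : c - m = c + ((-m : ℤ) : ℝ) := by push_cast; ring
  have h5 : c + m = c + ((m : ℤ) : ℝ) := by push_cast; ring
  rw [h4, h5, h2, h3, ← mul_add]
  congr 1
  push_cast
  rw [Complex.two_cos]
  congr 2
  all_goals ring

lemma sum_trapezoid (K : ℕ) (b c : ℝ) : ∑ k ∈ Finset.range K,
    (quadExp b c ((0 + k : ℝ) : ℂ) + quadExp b c ((1 + k : ℝ) : ℂ)) / 2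
      = ∑ k ∈ Finset.range (K + 1), quadExp b c k - (1 + quadExp b c K) / 2 := by
  induction K with
  | zero => simp [quadExp]
  | succ K ih =>
    rw [Finset.sum_range_succ, Finset.sum_range_succ _ (K + 1), ih]
    push_cast
    ring_nf

/-- Poisson summation on `[0,K]`: `hasSum_integral_cos` on every unit interval, added up. The series
runs over symmetric pairs because single terms need not be summable. -/
lemma hasSum_fres (K : ℕ) (b c : ℝ) :
    HasSum (fun n : ℕ => fres K b (c + (n + 1)) + fres K b (c - (n + 1)))
      (∑ k ∈ Finset.range (K + 1), quadExp b c k - (1 + quadExp b c K) / 2 - fres K b c) := by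
  have hk (k : ℕ) := hasSum_integral_cos (g := fun t : ℝ => quadExp b c ((t + k : ℝ) : ℂ))
    (g' := fun t : ℝ => 2 * Real.pi * Complex.I * (c + 2 * b * ((t + k : ℝ) : ℂ))
      * quadExp b c ((t + k : ℝ) : ℂ))
    (g'' := fun t : ℝ => 2 * Real.pi * Complex.I * (2 * b) * quadExp b c ((t + k : ℝ) : ℂ)
      + 2 * Real.pi * Complex.I * (c + 2 * b * ((t + k : ℝ) : ℂ)) *
      (2 * Real.pi * Complex.I * (c + 2 * b * ((t + k : ℝ) : ℂ)) * quadExp b c ((t + k : ℝ) : ℂ)))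
    (fun t => (hasDerivAt_quadExp b c (t + k)).comp_add_const t k)
    (fun t => by
      have h1 := (hasDerivAt_quadExp b c (t + k)).comp_add_const t k
      have h2 : HasDerivAt (fun t : ℝ => 2 * Real.pi * Complex.I * (c + 2 * b * ((t + k : ℝ) : ℂ)))
          (2 * Real.pi * Complex.I * (2 * b)) t := by
        have h3 : HasDerivAt (fun t : ℝ => ((t + k : ℝ) : ℂ)) ((1:ℝ):ℂ) t :=
          ((hasDerivAt_id t).add_const (k:ℝ)).ofReal_comp
        have := ((h3.const_mul (2 * b : ℂ)).const_add (c:ℂ)).const_mul (2 * Real.pi * Complex.I)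
        simpa using this
      exact h2.mul h1)
    (by have := continuous_quadExp b c; fun_prop)
  have hS := hasSum_sum (fun k (_ : k ∈ Finset.range K) => hk k)
  have hc (c : ℝ) := continuous_quadExp b c
  convert hS using 1
  · ext n
    rw [fres_eq_sum, fres_eq_sum, ← Finset.sum_add_distrib]
    refine Finset.sum_congr rfl fun k _ => ?_
    rw [← intervalIntegral.integral_add
      (by apply Continuous.intervalIntegrable; have := hc (c + (n + 1)); fun_prop)
      (by apply Continuous.intervalIntegrable; have := hc (c - (n + 1)); fun_prop)]
    congr 1
    ext t
    have := quadExp_add_sub b c (n + 1) k t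
    push_cast at this ⊢
    exact this
  · rw [Finset.sum_sub_distrib, ← fres_eq_sum]
    congr 1
    exact (sum_trapezoid K b c).symm

/-! ### Rearranging the Poisson sum -/

lemma sum_range_shift (h : ℤ → ℂ) (n : ℕ) :
    ∑ i ∈ Finset.range n, h (i + 1) = ∑ i ∈ Finset.range n, h i + h n - h 0 := by
  induction n with
  | zero => simp
  | succ n ih =>
    rw [Finset.sum_range_succ, Finset.sum_range_succ, ih]
    push_cast; ring

/-- Moving the centre of the partial sums from `0` to the window `[P, P + r]` changes them by `P +
r` terms at the far right and `P` at the far left. Their number stays fixed while their indices go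
to infinity with `n`. -/
lemma sum_window_eq (I : ℤ → ℂ) (P r n : ℕ) :
    ∑ j ∈ Finset.range (r + 1), I (P + j)
      + ∑ j ∈ Finset.range n, (I (P - (j + 1)) + I (P + r + (j + 1)))
    = I 0 + ∑ j ∈ Finset.range n, (I (j + 1) + I (-(j + 1)))
      + ∑ i ∈ Finset.range (P + r), I (i + (n + 1)) - ∑ i ∈ Finset.range P, I (i - n) := by
  induction n with
  | zero =>
    have h1 := Finset.sum_range_add (fun i : ℕ => I i) P (r + 1)
    have h2 := Finset.sum_range_succ' (fun i : ℕ => I i) (P + r)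
    rw [← add_assoc, h2] at h1
    push_cast at h1 ⊢
    simp only [Finset.range_zero, Finset.sum_empty, sub_zero, add_zero]
    linear_combination -h1
  | succ n ih =>
    rw [Finset.sum_range_succ _ n, Finset.sum_range_succ _ n, ← add_assoc, ih]
    have h1 := sum_range_shift (fun i => I (i + (n + 1))) (P + r)
    have h2 := sum_range_shift (fun i => I (i - (n + 1))) P
    have e1 (i : ℤ) : I (i + 1 - (n + 1)) = I (i - n) := by congr 1; ring
    have e2 (i : ℤ) : I (i + ((n + 1 : ℕ) + 1)) = I (i + 1 + (n + 1)) := by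
      congr 1; push_cast; ring
    have e3 (i : ℤ) : I (i - (n + 1 : ℕ)) = I (i - (n + 1)) := by congr 1
    simp only [e1] at h2
    simp only [e2, e3, h1, h2]
    push_cast
    rw [zero_add, zero_sub]
    ring

/-- Telescoping, from `1/n² ≤ 2(1/n - 1/(n + 1))`. -/
lemma norm_sub_le_of_tendsto {T : ℕ → ℂ} {S : ℂ} {c : ℝ} (hc : 0 ≤ c)
    (hT : Tendsto T atTop (𝓝 S)) (h : ∀ n : ℕ, 1 ≤ n → ‖T (n + 1) - T n‖ ≤ c / (n:ℝ) ^ 2)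
    {n : ℕ} (hn : 1 ≤ n) : ‖S - T n‖ ≤ 2 * c / n := by
  have hn0 : (1:ℝ) ≤ n := by exact_mod_cast hn
  have key (k : ℕ) : ‖T (n + k) - T n‖ ≤ 2 * c * (1 / n - 1 / (n + k)) := by
    induction k with
    | zero => simp
    | succ k ih =>
      have h1 := h (n + k) (by omega)
      have h2 : ‖T (n + (k + 1)) - T n‖ ≤ ‖T (n + k + 1) - T (n + k)‖ + ‖T (n + k) - T n‖ := by
        have := norm_add_le (T (n + k + 1) - T (n + k)) (T (n + k) - T n)
        simpa [add_assoc] using this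
      push_cast at h1 ⊢
      set y : ℝ := (n:ℝ) + k with hy
      have hy1 : 1 ≤ y := by
        have : (0:ℝ) ≤ k := by positivity
        linarith
      have h3 : c / y ^ 2 ≤ 2 * c * (1 / y - 1 / (y + 1)) := by
        have : 2 * c * (1 / y - 1 / (y + 1)) = c * (2 / (y * (y + 1))) := by field_simp; ring
        rw [this, div_eq_mul_one_div]
        apply mul_le_mul_of_nonneg_left _ hc
        rw [div_le_div_iff₀ (by positivity) (by positivity)]
        nlinarith
      rw [← add_assoc (n:ℝ) k 1, ← hy]
      linarith
  have hlim : Tendsto (fun k => ‖T (n + k) - T n‖) atTop (𝓝 ‖S - T n‖) := by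
    have : Tendsto (fun k => T (n + k)) atTop (𝓝 S) := by
      simpa [add_comm] using (tendsto_add_atTop_iff_nat n).2 hT
    exact (this.sub_const _).norm
  refine le_of_tendsto hlim (Eventually.of_forall fun k => (key k).trans ?_)
  have : (0:ℝ) ≤ 1 / (n + k) := by positivity
  have h2 : 2 * c / n = 2 * c * (1 / n) := by ring
  rw [h2]
  apply mul_le_mul_of_nonneg_left _ (by positivity)
  linarith

/-! ### Decay of the Fourier integrals at frequencies far from the window. -/

lemma norm_fres_le_of_pos {b c : ℝ} (hb : 0 ≤ b) (K : ℕ) (hc : 0 < c) :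
    ‖fres K b c‖ ≤ 1 / c := by
  have hpi := Real.pi_gt_three
  rw [fres_up]
  have h1 := norm_diag_le hb K hc
  have hc' : c ≤ c + 2 * b * K := by
    have : 0 ≤ 2 * b * K := by positivity
    linarith
  have h2 := norm_vert_le K b (hc.trans_le hc')
  have h3 : 1 / (2 * Real.pi * (c + 2 * b * K)) ≤ 1 / (2 * Real.pi * c) := by gcongr
  refine (norm_sub_le _ _).trans ?_
  have hq : ‖quadExp b c K‖ = 1 := norm_quadExp_ofReal b c K
  rw [norm_mul, norm_mul, norm_mul, hq, Complex.norm_I]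
  have h4 : 1 / (Real.pi * c) + 1 / (2 * Real.pi * c) ≤ 1 / c := by
    rw [show 1 / (Real.pi * c) + 1 / (2 * Real.pi * c) = (3 / (2 * Real.pi)) * (1 / c) by
      field_simp; norm_num]
    apply mul_le_of_le_one_left (by positivity)
    rw [div_le_one (by positivity)]
    linarith
  linarith

lemma norm_fres_le_of_neg {b c : ℝ} (hb : 0 ≤ b) (K : ℕ) (hc : c + 2 * b * K < 0) :
    ‖fres K b c‖ ≤ 1 / (-(c + 2 * b * K)) := by
  have hpi := Real.pi_gt_three
  rw [fres_down]
  set d : ℝ := -(c + 2 * b * K) with hd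
  have hd0 : 0 < d := by linarith
  have h1 := norm_diag_le hb K hd0
  have hc' : d ≤ -c := by
    have : 0 ≤ 2 * b * K := by positivity
    linarith
  have h2 := norm_vert_le K b (hd0.trans_le hc')
  have h3 : 1 / (2 * Real.pi * (-c)) ≤ 1 / (2 * Real.pi * d) := by gcongr
  refine (norm_add_le _ _).trans ?_
  have hq : ‖quadExp b c K‖ = 1 := norm_quadExp_ofReal b c K
  rw [norm_neg, norm_mul, norm_mul, norm_mul, hq, Complex.norm_I]
  have h4 : 1 / (Real.pi * d) + 1 / (2 * Real.pi * d) ≤ 1 / d := by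
    rw [show 1 / (Real.pi * d) + 1 / (2 * Real.pi * d) = (3 / (2 * Real.pi)) * (1 / d) by
      field_simp; norm_num]
    apply mul_le_of_le_one_left (by positivity)
    rw [div_le_one (by positivity)]
    linarith
  linarith

lemma tendsto_fres_atTop {b : ℝ} (hb : 0 ≤ b) (K : ℕ) : Tendsto (fres K b) atTop (𝓝 0) := by
  refine squeeze_zero_norm' ?_ (tendsto_inv_atTop_zero (𝕜 := ℝ))
  filter_upwards [eventually_gt_atTop 0] with c hc
  simpa using norm_fres_le_of_pos hb K hc

lemma tendsto_fres_atBot {b : ℝ} (hb : 0 ≤ b) (K : ℕ) : Tendsto (fres K b) atBot (𝓝 0) := by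
  have h : Tendsto (fun c : ℝ => -(c + 2 * b * K)) atBot atTop :=
    tendsto_neg_atBot_atTop.comp (tendsto_atBot_add_const_right _ _ tendsto_id)
  refine squeeze_zero_norm' ?_ ((tendsto_inv_atTop_zero (𝕜 := ℝ)).comp h)
  filter_upwards [eventually_lt_atBot (-(2 * b * K))] with c hc
  simpa using norm_fres_le_of_neg hb K (by linarith)

/-- The Poisson sum over windows growing from an arbitrary centre. -/
lemma tendsto_sum_window {b : ℝ} (hb : 0 ≤ b) (K : ℕ) (A : ℝ) (P r : ℕ) :
    Tendsto (fun n : ℕ => ∑ j ∈ Finset.range (r + 1), fres K b (A - (P + j))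
      + ∑ j ∈ Finset.range n, (fres K b (A - (P - (j + 1))) + fres K b (A - (P + r + (j + 1)))))
      atTop (𝓝 (∑ k ∈ Finset.range (K + 1), quadExp b A k - (1 + quadExp b A K) / 2)) := by
  have h0 := (hasSum_fres K b A).tendsto_sum_nat
  -- The terms exchanged by recentring tend to zero, at either end.
  have h1 : Tendsto (fun n : ℕ => ∑ i ∈ Finset.range (P + r), fres K b (A - (i + (n + 1))))
      atTop (𝓝 0) := by
    have := tendsto_finsetSum (Finset.range (P + r)) (fun i _ =>
      (tendsto_fres_atBot hb K).comp (?_ : Tendsto (fun n : ℕ => A - (i + ((n:ℝ) + 1))) atTop atBot))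
    · simpa using this
    · have h : Tendsto (fun n : ℕ => (A - i - 1) - (n:ℝ)) atTop atBot :=
        tendsto_atBot_add_const_left _ _ (tendsto_neg_atTop_atBot.comp tendsto_natCast_atTop_atTop)
      refine h.congr fun n => by ring
  have h2 : Tendsto (fun n : ℕ => ∑ i ∈ Finset.range P, fres K b (A - (i - n)))
      atTop (𝓝 0) := by
    have := tendsto_finsetSum (Finset.range P) (fun i _ =>
      (tendsto_fres_atTop hb K).comp (?_ : Tendsto (fun n : ℕ => A - (i - (n:ℝ))) atTop atTop))
    · simpa using this
    · have h : Tendsto (fun n : ℕ => (A - i) + (n:ℝ)) atTop atTop :=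
        tendsto_atTop_add_const_left _ _ tendsto_natCast_atTop_atTop
      refine h.congr fun n => by ring
  have h3 := ((h0.const_add (fres K b A)).add h1).sub h2
  have e : fres K b A + (∑ k ∈ Finset.range (K + 1), quadExp b A k - (1 + quadExp b A K) / 2
      - fres K b A) + 0 - 0
      = ∑ k ∈ Finset.range (K + 1), quadExp b A k - (1 + quadExp b A K) / 2 := by ring
  rw [e] at h3
  refine h3.congr fun n => ?_
  have := sum_window_eq (fun m : ℤ => fres K b (A - m)) P r n
  push_cast at this
  rw [this, sub_zero]
  congr 3
  refine Finset.sum_congr rfl fun j _ => ?_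
  rw [add_comm, sub_neg_eq_add]

/-! ### The tail of the Poisson sum -/

lemma exp_neg_le_inv_sq {x : ℝ} (hx : 0 < x) : Real.exp (-x) ≤ 2 / x ^ 2 := by
  rw [Real.exp_neg, inv_eq_one_div, div_le_div_iff₀ (Real.exp_pos _) (by positivity)]
  have := Real.quadratic_le_exp_of_nonneg hx.le
  nlinarith

/-- Each integral is only `O(1/n)`, but at nearby parameters the leading parts cancel, leaving a
summable difference. -/
lemma norm_diag_sub_vert_shift_le {b : ℝ} (hb : 0 ≤ b) {K n : ℕ} (hK : 1 ≤ K) (hn : 1 ≤ n)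
    {w w' d : ℝ} (hw : n ≤ w) (hw' : n ≤ w') (hd : |w' - w| ≤ d) :
    ‖diag K b w - vert K b w'‖ ≤ (d + 1) / (n:ℝ) ^ 2 := by
  have hpi := Real.pi_gt_three
  have hn' : (1:ℝ) ≤ n := by exact_mod_cast hn
  have hK' : (1:ℝ) ≤ K := by exact_mod_cast hK
  have hw0 : 0 < w := by linarith
  have hw0' : 0 < w' := by linarith
  have h1 := norm_diag_sub_vert_le hb K w
  have h2 : K * Real.exp (-(2 * Real.pi * w * K)) ≤ 1 / (n:ℝ) ^ 2 := by
    have h3 : 2 * n * (K:ℝ) ≤ 2 * Real.pi * w * K := by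
      have : 2 * (n:ℝ) ≤ 2 * Real.pi * w := by nlinarith
      nlinarith
    calc K * Real.exp (-(2 * Real.pi * w * K)) ≤ K * Real.exp (-(2 * n * (K:ℝ))) := by
          gcongr
      _ ≤ K * (2 / (2 * n * (K:ℝ)) ^ 2) := by
          gcongr
          exact exp_neg_le_inv_sq (by positivity)
      _ = (1 / (2 * K)) * (1 / (n:ℝ) ^ 2) := by field_simp
      _ ≤ 1 * (1 / (n:ℝ) ^ 2) := by
          gcongr
          rw [div_le_one (by positivity)]; linarith
      _ = _ := one_mul _
  have h3 : ‖vert K b w - vert K b w'‖ ≤ d / (n:ℝ) ^ 2 := by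
    have aux : ∀ {x y : ℝ}, n ≤ x → x ≤ y → y - x ≤ d →
        1 / (2 * Real.pi * x) - 1 / (2 * Real.pi * y) ≤ d / (n:ℝ) ^ 2 := by
      intro x y hx hxy hyd
      have hx0 : 0 < x := by linarith
      have hy0 : 0 < y := by linarith
      have e : 1 / (2 * Real.pi * x) - 1 / (2 * Real.pi * y) = (y - x) / (2 * Real.pi * (x * y)) := by
        field_simp
      rw [e]
      apply div_le_div₀ (by linarith) hyd (by positivity)
      have : (n:ℝ) ^ 2 ≤ x * y := by nlinarith
      nlinarith
    rcases le_total w w' with h | h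
    · exact (norm_vert_sub_vert_le K b hw0 h).trans (aux hw h ((le_abs_self _).trans hd))
    · rw [norm_sub_rev]
      refine (norm_vert_sub_vert_le K b hw0' h).trans (aux hw' h ?_)
      rw [← neg_sub]; exact (neg_le_abs _).trans hd
  have h4 : ‖diag K b w - vert K b w'‖ ≤ ‖diag K b w - vert K b w‖ + ‖vert K b w - vert K b w'‖ := by
    simpa using norm_add_le (diag K b w - vert K b w) (vert K b w - vert K b w')
  rw [add_div]
  linarith

lemma quadExp_sub_intCast (b A : ℝ) (m : ℤ) (K : ℕ) : quadExp b (A - m) K = quadExp b A K := by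
  have := quadExp_add_int_natCast b A (-m) K
  push_cast at this
  rwa [← sub_eq_add_neg] at this

/-- The pair of Poisson terms at distance `j + 1` from the saddle window `[P, P + r]`. -/
lemma fres_pair_eq (K : ℕ) (b A : ℝ) (P r j : ℕ) :
    fres K b (A - (P - (j + 1))) + fres K b (A - (P + r + (j + 1)))
      = Complex.I * (diag K b (1 - (P - A) + j) - vert K b ((2 * b * K - (A + 2 * b * K - (P + r)))
          + (j + 1)))
        + quadExp b A K * Complex.I * (diag K b (1 - (A + 2 * b * K - (P + r)) + j)
          - vert K b ((2 * b * K - (P - A)) + (j + 1))) := by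
  -- Frequencies below the window are pushed into the upper half-plane and those above it into the
  -- lower; in the application all the resulting decay parameters are then positive.
  rw [fres_up, fres_down K b (A - (P + r + (j + 1)))]
  have h1 := quadExp_sub_intCast b A (P - (j + 1)) K
  have h2 := quadExp_sub_intCast b A (P + r + (j + 1)) K
  push_cast at h1 h2
  rw [h1, h2]
  have e1 : A - (P - ((j:ℝ) + 1)) = 1 - (P - A) + j := by ring
  have e2 : -(A - ((P:ℝ) + r + (j + 1))) = (2 * b * K - (A + 2 * b * K - (P + r))) + (j + 1) := by
    ring
  have e3 : -(A - ((P:ℝ) + r + (j + 1)) + 2 * b * K) = 1 - (A + 2 * b * K - (P + r)) + j := by ring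
  have e4 : 1 - (P - A) + j + 2 * b * K = (2 * b * K - (P - A)) + ((j:ℝ) + 1) := by ring
  rw [e3, e2, e1, e4]
  ring

/-! ### The truncated Poisson formula -/

lemma natCast_le_exp (K : ℕ) : (K:ℝ) + 1 ≤ Real.exp K := Real.add_one_le_exp _

lemma natCast_sq_mul_exp_le {K : ℕ} :
    ((K:ℝ) + 1) * ((K + 1) * Real.exp (-(2 * Real.pi * K))) ≤ Real.exp (-(K:ℝ)) := by
  have h := natCast_le_exp K
  have h0 : (0:ℝ) ≤ K := by positivity
  calc ((K:ℝ) + 1) * ((K + 1) * Real.exp (-(2 * Real.pi * K)))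
      ≤ Real.exp K * (Real.exp K * Real.exp (-(2 * Real.pi * K))) := by gcongr
    _ = Real.exp (K + (K + -(2 * Real.pi * K))) := by rw [Real.exp_add, Real.exp_add]
    _ ≤ _ := by
      apply Real.exp_le_exp.2
      nlinarith [Real.pi_gt_three]

/-- Only the parameter of the term `j = 0` can be close to zero, so that term stays on `C₇`; the
others move to the vertical contour at exponentially small cost. The vertical integral at distance
`M` is added to complete a `J` with `M` terms, at cost `1/M`. -/
lemma norm_sum_diag_sub_le {b : ℝ} (hb : 0 ≤ b) {K M : ℕ} (hK : 1 ≤ K) (hM : 1 ≤ M) {v : ℝ}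
    (hv : 0 < v) :
    ‖∑ j ∈ Finset.range M, diag K b (v + j)
      - (diag K b v + ∑ j ∈ Finset.range M, vert K b (v + (j + 1)))‖
      ≤ 2 * Real.exp (-(K:ℝ)) + 1 / M := by
  have hpi := Real.pi_gt_three
  have hK' : (1:ℝ) ≤ K := by exact_mod_cast hK
  obtain ⟨n, rfl⟩ : ∃ n, M = n + 1 := ⟨M - 1, by omega⟩
  have h0 : ∑ j ∈ Finset.range (n + 1), diag K b (v + j)
      - (diag K b v + ∑ j ∈ Finset.range (n + 1), vert K b (v + (j + 1)))
      = ∑ j ∈ Finset.range n, (diag K b (v + (j + 1)) - vert K b (v + (j + 1)))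
        - vert K b (v + (n + 1)) := by
    rw [Finset.sum_range_succ', Finset.sum_range_succ (fun j : ℕ => vert K b (v + (j + 1))),
      Finset.sum_sub_distrib]
    push_cast
    rw [add_zero]; ring
  rw [h0]
  refine (norm_sub_le _ _).trans (add_le_add ?_ ?_)
  · refine (norm_sum_le _ _).trans ?_
    have hterm : ∀ j ∈ Finset.range n, ‖diag K b (v + (j + 1)) - vert K b (v + (j + 1))‖
        ≤ Real.exp (-(K:ℝ)) * (1 / 2) ^ j := by
      intro j _
      refine (norm_diag_sub_vert_le hb K _).trans ?_
      have h1 : Real.exp (-(2 * Real.pi * (v + (j + 1)) * K))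
          ≤ Real.exp (-(2 * Real.pi * K)) * Real.exp (-1) ^ j := by
        rw [← Real.exp_nat_mul, ← Real.exp_add]
        apply Real.exp_le_exp.2
        have hj : (0:ℝ) ≤ j := by positivity
        have h2 : 0 ≤ Real.pi * v * K := by positivity
        have h3 : (j:ℝ) ≤ 2 * Real.pi * (j * K) := by
          have : (j:ℝ) ≤ j * K := by nlinarith
          nlinarith
        nlinarith
      have h2 : Real.exp (-1) ≤ 1 / 2 := by
        rw [Real.exp_neg, inv_eq_one_div]
        apply one_div_le_one_div_of_le (by norm_num)
        linarith [Real.add_one_le_exp (1:ℝ)]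
      have h3 : Real.exp (-1) ^ j ≤ (1 / 2) ^ j := by gcongr
      have h4 := natCast_sq_mul_exp_le (K := K)
      have h5 := Real.exp_pos (-(2 * Real.pi * K))
      calc K * Real.exp (-(2 * Real.pi * (v + (j + 1)) * K))
          ≤ K * (Real.exp (-(2 * Real.pi * K)) * (1 / 2) ^ j) := by
            gcongr
            exact h1.trans (by gcongr)
        _ = (K * Real.exp (-(2 * Real.pi * K))) * (1 / 2) ^ j := by ring
        _ ≤ _ := by
            gcongr
            refine le_trans ?_ h4
            have : (K:ℝ) * Real.exp (-(2 * Real.pi * K)) ≤ (K + 1) * Real.exp (-(2 * Real.pi * K)) := by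
              gcongr; linarith
            have : 0 ≤ (K:ℝ) * ((K + 1) * Real.exp (-(2 * Real.pi * K))) := by positivity
            linarith
    refine (Finset.sum_le_sum hterm).trans ?_
    rw [← Finset.mul_sum, mul_comm 2]
    gcongr
    exact sum_geometric_two_le n
  · refine (norm_vert_le K b (by positivity)).trans ?_
    push_cast
    apply one_div_le_one_div_of_le (by positivity)
    have hn : (0:ℝ) ≤ n := by positivity
    nlinarith

/-- The same device for the half-line integrals left over by the saddles: truncation is harmless for
every `j`, the change of contour for `j ≥ 1`. There are at most `K + 1` terms, which the exponential
absorbs. -/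
lemma norm_sum_diagInf_sub_le {b : ℝ} (hb : 0 ≤ b) {K r : ℕ} (hK : 1 ≤ 2 * b * K) (hr : r ≤ K)
    {v : ℝ} (hv : 0 ≤ v) :
    ‖∑ j ∈ Finset.range (r + 1), diagInf b (v + j)
      - (diag K b v + ∑ j ∈ Finset.range r, vert K b (v + (j + 1)))‖ ≤ Real.exp (-(K:ℝ)) := by
  have h0 : ∑ j ∈ Finset.range (r + 1), diagInf b (v + j)
      - (diag K b v + ∑ j ∈ Finset.range r, vert K b (v + (j + 1)))
      = ∑ j ∈ Finset.range (r + 1), (diagInf b (v + j)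
          - if j = 0 then diag K b v else vert K b (v + j)) := by
    rw [Finset.sum_sub_distrib, Finset.sum_range_succ' (fun j : ℕ => if j = 0 then _ else _)]
    simp only [Nat.add_eq_zero_iff, one_ne_zero, and_false, if_false, if_true]
    push_cast
    ring
  rw [h0]
  have hterm : ∀ j ∈ Finset.range (r + 1), ‖diagInf b (v + j)
      - if j = 0 then diag K b v else vert K b (v + j)‖
        ≤ (K + 1) * Real.exp (-(2 * Real.pi * K)) := by
    intro j _
    have hpi := Real.pi_pos
    have hvj : 0 ≤ v + j := by positivity
    have h1 := norm_diagInf_sub_le hvj K hK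
    have h2 := Real.exp_pos (-(2 * Real.pi * K))
    have h3 : (0:ℝ) ≤ K * Real.exp (-(2 * Real.pi * K)) := by positivity
    split_ifs with hj
    · subst hj
      simp only [Nat.cast_zero, add_zero] at h1 ⊢
      linarith
    · have h4 := norm_diag_sub_vert_le hb K (v + j)
      have h5 : Real.exp (-(2 * Real.pi * (v + j) * K)) ≤ Real.exp (-(2 * Real.pi * K)) := by
        apply Real.exp_le_exp.2
        have : (1:ℝ) ≤ j := by exact_mod_cast Nat.one_le_iff_ne_zero.2 hj
        have h6 : (0:ℝ) ≤ 2 * Real.pi * K := by positivity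
        nlinarith
      have h6 : (K:ℝ) * Real.exp (-(2 * Real.pi * (v + j) * K)) ≤ K * Real.exp (-(2 * Real.pi * K)) := by
        gcongr
      have h7 := norm_add_le (diagInf b (v + j) - diag K b (v + j))
        (diag K b (v + j) - vert K b (v + j))
      rw [sub_add_sub_cancel] at h7
      linarith
  refine (norm_sum_le _ _).trans ((Finset.sum_le_sum hterm).trans ?_)
  rw [Finset.sum_const, Finset.card_range, nsmul_eq_mul]
  refine le_trans ?_ (natCast_sq_mul_exp_le (K := K))
  push_cast
  have : (r:ℝ) ≤ K := by exact_mod_cast hr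
  gcongr

/-- The truncated Poisson formula: the theta sum in terms of its saddle point contributions and
incomplete integrals along steepest descent contours. -/
lemma norm_theta_sub_le {K M P r : ℕ} {A b : ℝ} (hb : 0 ≤ b) (hb4 : b ≤ 1 / 4) (hM : 1 ≤ M)
    (hr : 1 ≤ r) (hP : A ≤ P) (hP' : P < A + 1) (hQ : P + r ≤ A + 2 * b * K)
    (hQ' : A + 2 * b * K < P + r + 1) :
    ‖∑ k ∈ Finset.range (K + 1), quadExp b A k
      - (Complex.exp (Real.pi * Complex.I / 4) * ∑ j ∈ Finset.range (r + 1), gauss (A - (P + j)) b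
        + (1 + quadExp b A K) / 2
        + Complex.I * (diag K b (1 - (P - A)) + J K 0 M (1 - (P - A)) b
          - J K 0 M (2 * b * K - (A + 2 * b * K - (P + r))) b)
        + quadExp b A K * Complex.I * (diag K b (1 - (A + 2 * b * K - (P + r)))
          + J K 0 M (1 - (A + 2 * b * K - (P + r))) b - J K 0 M (2 * b * K - (P - A)) b)
        - Complex.I * (diag K b (P - A) + J K 0 r (P - A) b)
        - quadExp b A K * Complex.I * (diag K b (A + 2 * b * K - (P + r))
          + J K 0 r (A + 2 * b * K - (P + r)) b))‖
      ≤ 12 * (K / M + Real.exp (-(K:ℝ))) := by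
  have hr' : (1:ℝ) ≤ r := by exact_mod_cast hr
  have h2bK : (r:ℝ) ≤ 2 * b * K := by linarith
  have hrK : r ≤ K := by
    have : (r:ℝ) ≤ K := by
      have : (0:ℝ) ≤ K := by positivity
      nlinarith
    exact_mod_cast this
  have hK : 1 ≤ K := hr.trans hrK
  have hK' : (1:ℝ) ≤ K := by exact_mod_cast hK
  have hbpos : 0 < b := by
    by_contra h
    nlinarith
  have hM' : (1:ℝ) ≤ M := by exact_mod_cast hM
  obtain ⟨w1, hw1⟩ : ∃ w1 : ℝ, w1 = P - A := ⟨_, rfl⟩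
  obtain ⟨w, hw⟩ : ∃ w : ℝ, w = A + 2 * b * K - (P + r) := ⟨_, rfl⟩
  rw [← hw1, ← hw]
  have hw10 : 0 ≤ w1 := by linarith
  have hw11 : w1 < 1 := by linarith
  have hw0 : 0 ≤ w := by linarith
  have hw2 : w < 1 := by linarith
  set κ := quadExp b A K with hκ
  have hκn : ‖κ‖ = 1 := norm_quadExp_ofReal b A K
  -- the tail
  have hlim := tendsto_sum_window hb K A P r
  simp_rw [fres_pair_eq, ← hw1, ← hw, ← hκ] at hlim
  -- Since `2bK ≤ K/2`, the parameters compared differ by at most `K/2 + 1`. Each half of a pair is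
  -- then at most `(K/2 + 2)/n²`, and `K + 4 ≤ 5K`.
  have htail := norm_sub_le_of_tendsto (c := 5 * K) (by positivity) hlim (by
    intro n hn
    rw [Finset.sum_range_succ _ n, ← add_assoc, add_sub_cancel_left]
    have hn' : (1:ℝ) ≤ n := by exact_mod_cast hn
    have h1 := norm_diag_sub_vert_shift_le hb hK hn (w := 1 - w1 + n)
      (w' := 2 * b * K - w + (n + 1)) (d := K / 2 + 1) (by linarith) (by linarith) (by
        rw [abs_le]; constructor <;> nlinarith)
    have h2 := norm_diag_sub_vert_shift_le hb hK hn (w := 1 - w + n)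
      (w' := 2 * b * K - w1 + (n + 1)) (d := K / 2 + 1) (by linarith) (by linarith) (by
        rw [abs_le]; constructor <;> nlinarith)
    refine (norm_add_le _ _).trans ?_
    rw [norm_mul, norm_mul, norm_mul, hκn, Complex.norm_I, one_mul, one_mul, one_mul]
    refine (add_le_add h1 h2).trans ?_
    rw [← add_div]
    gcongr
    linarith) hM
  -- the pairs
  have hpair1 := norm_sum_diag_sub_le hb hK hM (v := 1 - w1) (by linarith)
  have hpair2 := norm_sum_diag_sub_le hb hK hM (v := 1 - w) (by linarith)
  -- the saddle window
  have hone : 1 ≤ 2 * b * K := by linarith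
  have hsad1 := norm_sum_diagInf_sub_le hb hone hrK hw10
  have hsad2 := norm_sum_diagInf_sub_le hb hone hrK hw0
  -- `diagInf` at the parameter `A - (P + j)` is traded for a Gaussian minus `diagInf` at the
  -- opposite, nonnegative parameter. At the endpoint `K` the parameters are `w + (r - j)`, hence
  -- the reflected sum.
  have hwin : ∑ j ∈ Finset.range (r + 1), fres K b (A - (P + j))
      = Complex.exp (Real.pi * Complex.I / 4) * ∑ j ∈ Finset.range (r + 1), gauss (A - (P + j)) b
        - Complex.I * ∑ j ∈ Finset.range (r + 1), diagInf b (w1 + j)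
        - κ * Complex.I * ∑ j ∈ Finset.range (r + 1), diagInf b (w + j) := by
    rw [← Finset.sum_range_reflect (fun j : ℕ => diagInf b (w + j)), Finset.mul_sum,
      Finset.mul_sum, Finset.mul_sum, ← Finset.sum_sub_distrib, ← Finset.sum_sub_distrib]
    refine Finset.sum_congr rfl fun j hj => ?_
    rw [← diagInf_add_neg hbpos, fres_eq_diagInf hbpos]
    have h1 := quadExp_sub_intCast b A (P + j) K
    push_cast at h1
    rw [h1, ← hκ]
    have e1 : -(A - ((P:ℝ) + j)) = w1 + j := by rw [hw1]; ring
    have e2 : A - ((P:ℝ) + j) + 2 * b * K = w + ((r + 1 - 1 - j : ℕ) : ℝ) := by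
      rw [Finset.mem_range] at hj
      rw [Nat.add_sub_cancel, Nat.cast_sub (by omega), hw]; ring
    rw [e1, e2]
    ring
  rw [hwin] at htail
  simp_rw [J_eq_sum]
  rw [Finset.sum_add_distrib, ← Finset.mul_sum, ← Finset.mul_sum, Finset.sum_sub_distrib,
    Finset.sum_sub_distrib] at htail
  obtain ⟨d1, hd1⟩ : ∃ x, x = ∑ j ∈ Finset.range M, diag K b (1 - w1 + j)
    - (diag K b (1 - w1) + ∑ j ∈ Finset.range M, vert K b (1 - w1 + (j + 1))) := ⟨_, rfl⟩
  obtain ⟨d2, hd2⟩ : ∃ x, x = ∑ j ∈ Finset.range M, diag K b (1 - w + j)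
    - (diag K b (1 - w) + ∑ j ∈ Finset.range M, vert K b (1 - w + (j + 1))) := ⟨_, rfl⟩
  obtain ⟨d3, hd3⟩ : ∃ x, x = ∑ j ∈ Finset.range (r + 1), diagInf b (w1 + j)
      - (diag K b w1 + ∑ j ∈ Finset.range r, vert K b (w1 + (j + 1))) := ⟨_, rfl⟩
  obtain ⟨d4, hd4⟩ : ∃ x, x = ∑ j ∈ Finset.range (r + 1), diagInf b (w + j)
      - (diag K b w + ∑ j ∈ Finset.range r, vert K b (w + (j + 1))) := ⟨_, rfl⟩
  rw [← hd1] at hpair1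
  rw [← hd2] at hpair2
  rw [← hd3] at hsad1
  rw [← hd4] at hsad2
  rw [sub_eq_iff_eq_add.1 hd1.symm, sub_eq_iff_eq_add.1 hd2.symm, sub_eq_iff_eq_add.1 hd3.symm,
    sub_eq_iff_eq_add.1 hd4.symm] at htail
  obtain ⟨T, hT⟩ : ∃ T : ℂ, ‖T‖ ≤ 2 * (5 * K) / M ∧ T = _ := ⟨_, htail, rfl⟩
  -- The errors add up to `10K/M` from the tail, `2/M` from the completed sums, and `6e^{-K}` from
  -- the changes of contour.
  have hn : ‖T + Complex.I * d1 + κ * Complex.I * d2 - Complex.I * d3 - κ * Complex.I * d4‖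
      ≤ 12 * (K / M + Real.exp (-(K:ℝ))) := by
    have n1 : ‖Complex.I * d1‖ = ‖d1‖ := by rw [norm_mul, Complex.norm_I, one_mul]
    have n2 : ‖κ * Complex.I * d2‖ = ‖d2‖ := by
      rw [norm_mul, norm_mul, hκn, Complex.norm_I, one_mul, one_mul]
    have n3 : ‖Complex.I * d3‖ = ‖d3‖ := by rw [norm_mul, Complex.norm_I, one_mul]
    have n4 : ‖κ * Complex.I * d4‖ = ‖d4‖ := by
      rw [norm_mul, norm_mul, hκn, Complex.norm_I, one_mul, one_mul]
    have := norm_sub_le (T + Complex.I * d1 + κ * Complex.I * d2 - Complex.I * d3) (κ * Complex.I * d4)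
    have := norm_sub_le (T + Complex.I * d1 + κ * Complex.I * d2) (Complex.I * d3)
    have := norm_add₃_le (a := T) (b := Complex.I * d1) (c := κ * Complex.I * d2)
    have h1M : 1 / (M:ℝ) ≤ K / M := by gcongr
    have e1 : 2 * (5 * K) / (M:ℝ) = 10 * (K / M) := by ring
    have := Real.exp_pos (-(K:ℝ))
    have := hT.1
    linarith
  refine le_of_eq_of_le ?_ hn
  rw [hT.2]
  congr 1
  ring

/-! ### The coefficients of the remainder -/

/-- `exp(πi/4)`. -/
noncomputable def e8 : ℂ := Complex.exp (Real.pi * Complex.I / 4)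

/-- The phase of the `m`-th saddle point contribution, apart from the factor depending on `x`. -/
noncomputable def saddlePhase (a b : ℝ) (m : ℕ) : ℂ := quadExp (-(1 / (4 * b))) (a / (2 * b)) m

/-- The coefficients of the constant `1` and of the eighteen functions in the remainder. -/
noncomputable def coef (K : ℕ) (a b : ℝ) : Fin 19 → ℂ :=
  let κ : ℂ := quadExp b a K
  let m : ℕ := Kstar K b
  -- The values `1/2` and `κ/2` are the half-weighted ends of the sum, and `-e8` removes the dual
  -- term `m = 0`. Entries `12` and `14` vanish: this choice of contours never produces the
  -- integrals along `C₀`.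
  ![1 / 2, -Complex.I, -(κ * Complex.I), -Complex.I, -(κ * Complex.I), Complex.I, κ * Complex.I,
    Complex.I, κ * Complex.I, -Complex.I, -(κ * Complex.I), -e8, 0, κ / 2, 0,
    -(e8 * saddlePhase a b 1), e8 * saddlePhase a b (m + 1), e8 * saddlePhase a b (m + 1),
    e8 * saddlePhase a b (m + 2)]

lemma norm_e8 : ‖e8‖ = 1 := by
  rw [e8, show Real.pi * Complex.I / 4 = ((Real.pi / 4 : ℝ) : ℂ) * Complex.I by push_cast; ring,
    Complex.norm_exp_ofReal_mul_I]

lemma norm_saddlePhase (a b : ℝ) (m : ℕ) : ‖saddlePhase a b m‖ = 1 :=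
  norm_quadExp_ofReal _ _ (m:ℝ)

lemma norm_quadExp_natCast (a b : ℝ) (m : ℕ) : ‖quadExp b a m‖ = 1 :=
  norm_quadExp_ofReal _ _ (m:ℝ)

lemma norm_coef_le (K : ℕ) (a b : ℝ) (i : Fin 19) : ‖coef K a b i‖ ≤ 1 := by
  fin_cases i <;> simp [coef, norm_e8, norm_saddlePhase, norm_quadExp_natCast] <;> norm_num

lemma F_eq_sum (K : ℕ) (a b : ℝ) :
    F K 0 a b = ∑ k ∈ Finset.range (K + 1), quadExp b a k := by
  simp only [F, pow_zero, div_one, one_mul]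
  refine Finset.sum_congr rfl fun k _ => ?_
  unfold quadExp
  congr 1; ring

lemma e_eq (y : ℝ) : e y = Complex.exp (2 * Real.pi * Complex.I * y) := rfl

lemma quadExp_shift (b a y : ℝ) (m : ℕ) :
    quadExp b (a + y) m = e (y * m) * quadExp b a m := by
  unfold quadExp
  rw [e_eq, ← Complex.exp_add]
  congr 1; push_cast; ring

/-- Completing the square: `-(A - m)²/(4b) = -A²/(4b) + Am/(2b) - m²/(4b)`, which is the phase of
the dual theta sum. -/
lemma gauss_sub (A : ℝ) {b : ℝ} (hb : 0 < b) (m : ℕ) :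
    gauss (A - m) b = gauss A b * saddlePhase A b m := by
  have hbc : (b:ℂ) ≠ 0 := by exact_mod_cast hb.ne'
  unfold gauss saddlePhase quadExp
  rw [mul_assoc (1 / (Real.sqrt (2 * b) : ℂ)), ← Complex.exp_add]
  congr 2
  push_cast
  field_simp
  ring

lemma saddlePhase_shift (a y b : ℝ) (m : ℕ) :
    saddlePhase (a + y) b m = e (y * m / (2 * b)) * saddlePhase a b m := by
  unfold saddlePhase
  rw [add_div, quadExp_shift, div_mul_eq_mul_div]

lemma saddlePhase_zero (a b : ℝ) : saddlePhase a b 0 = 1 := by simp [saddlePhase, quadExp]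

/-- The saddle point sum is the dual theta sum up to boundary terms. -/
lemma sum_saddle_eq (h : ℕ → ℂ) {P r s : ℕ} (hP1 : 1 ≤ P) (hP2 : P ≤ 2) (hs : s ≤ P + r)
    (hs' : P + r ≤ s + 2) :
    ∑ j ∈ Finset.range (r + 1), h (P + j) = ∑ m ∈ Finset.range (s + 1), h m - h 0
      - delta (2 - P) * h 1 + delta ((P + r : ℕ) - s - 1) * h (s + 1)
      + delta ((P + r : ℕ) - s - 2) * h (s + 1) + delta ((P + r : ℕ) - s - 2) * h (s + 2) := by
  have h1 := Finset.sum_range_add h P (r + 1)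
  have h2 : ∑ m ∈ Finset.range P, h m = h 0 + delta (2 - P) * h 1 := by
    obtain rfl | rfl : P = 1 ∨ P = 2 := by omega
    · simp [delta]
    · simp [delta, Finset.sum_range_succ]
  have h3 : ∑ m ∈ Finset.range (P + (r + 1)), h m = ∑ m ∈ Finset.range (s + 1), h m
      + delta ((P + r : ℕ) - s - 1) * h (s + 1)
      + delta ((P + r : ℕ) - s - 2) * h (s + 1) + delta ((P + r : ℕ) - s - 2) * h (s + 2) := by
    rw [← add_assoc]
    obtain e | e | e : P + r = s ∨ P + r = s + 1 ∨ P + r = s + 2 := by omega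
    · rw [e]; simp [delta]
    · rw [e]; simp [delta, Finset.sum_range_succ]
    · rw [e]
      have d1 : delta ((s + 2 : ℕ) - s - 1) = 0 := by simp [delta]
      have d2 : delta ((s + 2 : ℕ) - s - 2) = 1 := by simp [delta]
      rw [d1, d2, Finset.sum_range_succ _ (s + 2), Finset.sum_range_succ _ (s + 1)]
      ring
  rw [h3, h2] at h1
  linear_combination -h1

/-- Since `e^ν = K/ε`, one has `M ≥ K⁴/ε`, so the tail `K/M` is even below `ε/K³`. -/
lemma natCast_div_MM_le {K : ℕ} {ε : ℝ} (hK : 0 < K) (hε : 0 < ε) :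
    1 ≤ (MM K ε).toNat ∧ ((MM K ε).toNat : ℤ) = MM K ε ∧ (K:ℝ) / (MM K ε).toNat ≤ ε / K ^ 2 := by
  have hK' : (1:ℝ) ≤ K := by exact_mod_cast hK
  have h1 : (K:ℝ) ^ 4 / ε ≤ MM K ε := by
    refine le_trans (le_of_eq ?_) (Int.le_ceil _)
    rw [nu, Real.exp_log (by positivity)]; ring
  have h2 : (0:ℝ) < MM K ε := lt_of_lt_of_le (by positivity) h1
  have h3 : 0 < MM K ε := by exact_mod_cast h2
  have h4 : ((MM K ε).toNat : ℤ) = MM K ε := Int.toNat_of_nonneg h3.le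
  refine ⟨by omega, h4, ?_⟩
  have h5 : (((MM K ε).toNat : ℕ) : ℝ) = MM K ε := by exact_mod_cast h4
  rw [h5, div_le_div_iff₀ h2 (by positivity)]
  rw [div_le_iff₀ hε] at h1
  have h6 : (K:ℝ) * K ^ 2 ≤ K ^ 4 := by
    rw [← pow_succ']; exact pow_le_pow_right₀ hK' (by norm_num)
  linarith

/-- The transformation formula with remainder at a single point. -/
lemma norm_F_sub_le {K : ℕ} {ε α a b x : ℝ} (hK : 0 < K) (hε : 0 < ε) (hb : 0 ≤ b)
    (hb4 : b ≤ 1 / 4) (hpq : p (a + α * x) < q K (a + α * x) b)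
    (hA : a + α * x ∈ Set.Ioo (0 : ℝ) 2) :
    ‖F K 0 (a + α * x) b
        - (Complex.exp (Real.pi * Complex.I / 4) * gauss (a + α * x) b
            * F (Kstar K b) 0 ((a + α * x) / (2 * b)) (-(1 / (4 * b)))
          + ∑ i, coef K a b i * remFun K ε α a b x i)‖
      ≤ 12 * (ε / (K : ℝ) ^ 2 + Real.exp (-(K : ℝ))) := by
  obtain ⟨A, hAdef⟩ : ∃ A, A = a + α * x := ⟨_, rfl⟩
  rw [← hAdef] at hpq hA ⊢
  obtain ⟨hA0, hA2⟩ := hA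
  obtain ⟨hM1, hMc, hMK⟩ := natCast_div_MM_le hK hε
  set M := (MM K ε).toNat with hM
  have hp1 : 1 ≤ p A := by
    have : 0 < p A := Int.ceil_pos.2 hA0
    omega
  have hp2 : p A ≤ 2 := Int.ceil_le.2 (by exact_mod_cast hA2.le)
  obtain ⟨P, hP⟩ : ∃ P : ℕ, (P : ℤ) = p A := ⟨(p A).toNat, Int.toNat_of_nonneg (by omega)⟩
  obtain ⟨r, hr⟩ : ∃ r : ℕ, (r : ℤ) = p1 K A b :=
    ⟨(p1 K A b).toNat, Int.toNat_of_nonneg (by unfold p1; omega)⟩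
  have hQ : ((P + r : ℕ) : ℤ) = q K A b := by
    push_cast; rw [hP, hr, p1]; ring
  have hPr : (P : ℝ) = p A := by exact_mod_cast congrArg (Int.cast : ℤ → ℝ) hP
  have hQr : (P : ℝ) + r = q K A b := by exact_mod_cast congrArg (Int.cast : ℤ → ℝ) hQ
  have hAP : A ≤ P := by rw [hPr]; exact Int.le_ceil A
  have hAP' : P < A + 1 := by rw [hPr]; exact Int.ceil_lt_add_one A
  have hAQ : (P:ℝ) + r ≤ A + 2 * b * K := by rw [hQr]; exact Int.floor_le _
  have hAQ' : A + 2 * b * K < P + r + 1 := by rw [hQr]; exact Int.lt_floor_add_one _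
  have hr1 : 1 ≤ r := by
    have : 0 < (r:ℤ) := by rw [hr, p1]; omega
    omega
  have hr1' : (1:ℝ) ≤ r := by exact_mod_cast hr1
  have hbpos : 0 < b := by
    by_contra h
    have : (0:ℝ) ≤ K := by positivity
    nlinarith
  have hkey := norm_theta_sub_le hb hb4 hM1 hr1 hAP hAP' hAQ hAQ'
  have hw : A + 2 * b * K - (P + r) = om K A b := by
    rw [hQr, om, Int.fract, q]
  have hw1 : P - A = om1 A := by rw [hPr, om1]
  rw [hw, hw1] at hkey
  refine (le_of_eq ?_).trans (hkey.trans (by gcongr))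
  have hs0 : (0:ℝ) ≤ 2 * b * K := by positivity
  -- As `0 < A < 2`, the top `⌊A + 2bK⌋` of the window is one of `K*`, `K* + 1`, `K* + 2`.
  have hs1 : Kstar K b ≤ P + r := by
    have h1 : ((Kstar K b : ℕ) : ℝ) ≤ 2 * b * K := Nat.floor_le hs0
    have : ((Kstar K b : ℕ) : ℝ) < ((P + r + 1 : ℕ) : ℝ) := by push_cast; linarith
    have : Kstar K b < P + r + 1 := by exact_mod_cast this
    omega
  have hs2 : P + r ≤ Kstar K b + 2 := by
    have h1 : 2 * b * K < (Kstar K b : ℕ) + 1 := Nat.lt_floor_add_one _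
    have : ((P + r : ℕ) : ℝ) < ((Kstar K b + 3 : ℕ) : ℝ) := by push_cast; linarith
    have : P + r < Kstar K b + 3 := by exact_mod_cast this
    omega
  have hsad := sum_saddle_eq (fun m => saddlePhase A b m) (P := P) (r := r) (s := Kstar K b)
    (by omega) (by omega) hs1 hs2
  have hgs : ∑ j ∈ Finset.range (r + 1), gauss (A - (P + j)) b
      = gauss A b * ∑ j ∈ Finset.range (r + 1), saddlePhase A b (P + j) := by
    rw [Finset.mul_sum]
    refine Finset.sum_congr rfl fun j _ => ?_
    rw [← gauss_sub A hbpos]; push_cast; rfl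
  have hsh (m : ℕ) : saddlePhase A b m = e (α * x * m / (2 * b)) * saddlePhase a b m := by
    rw [hAdef, saddlePhase_shift]
  have hF : F (Kstar K b) 0 (A / (2 * b)) (-(1 / (4 * b)))
      = ∑ m ∈ Finset.range (Kstar K b + 1), saddlePhase A b m := F_eq_sum _ _ _
  rw [← hF, hQ, hP, saddlePhase_zero, hsh 1, hsh (Kstar K b + 1), hsh (Kstar K b + 2)] at hsad
  -- Here and in `hsh` the dependence on `x` splits off as a unimodular factor that belongs to the
  -- functions of the remainder.
  have hκ : quadExp b A K = e (α * x * K) * quadExp b a K := by rw [hAdef, quadExp_shift]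
  rw [F_eq_sum, hgs, hsad, hκ]
  congr 2
  have hsum : ∑ i, coef K a b i * remFun K ε α a b x i = coef K a b ⬝ᵥ remFun K ε α a b x := rfl
  rw [hsum]
  simp only [coef, remFun, ← hAdef, Matrix.cons_dotProduct_cons, Matrix.dotProduct_of_isEmpty]
  rw [← hMc, ← hr]
  simp only [ItC7_eq, ← dir7.eq_1, ← diag.eq_1]
  rw [e8]
  push_cast
  simp only [mul_one]
  ring

end TruncTheta

namespace TruncTheta

/-! ### Rounding -/

lemma abs_floor_div_sub_le (B : ℕ) (y : ℝ) : |(⌊y * 2 ^ B⌋ : ℝ) / 2 ^ B - y| ≤ 1 / 2 ^ B := by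
  have h2 : (0:ℝ) < 2 ^ B := by positivity
  have e : (⌊y * 2 ^ B⌋ : ℝ) / 2 ^ B - y = (⌊y * 2 ^ B⌋ - y * 2 ^ B) / 2 ^ B := by field_simp
  rw [e, abs_div, abs_of_pos h2]
  gcongr
  have h1 := Int.floor_le (y * 2 ^ B)
  have h3 := Int.lt_floor_add_one (y * 2 ^ B)
  rw [abs_le]; constructor <;> linarith

lemma norm_roundTo_sub_le (B : ℕ) (z : ℂ) : ‖roundTo B z - z‖ ≤ 2 * (1 / 2 ^ B) := by
  have e : roundTo B z - z = (((⌊z.re * 2 ^ B⌋ : ℝ) / 2 ^ B - z.re : ℝ) : ℂ)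
      + (((⌊z.im * 2 ^ B⌋ : ℝ) / 2 ^ B - z.im : ℝ) : ℂ) * Complex.I := by
    nth_rewrite 2 [← Complex.re_add_im z]
    unfold roundTo
    push_cast; ring
  rw [e]
  refine (norm_add_le _ _).trans ?_
  rw [norm_mul, Complex.norm_I, mul_one, Complex.norm_real, Complex.norm_real, Real.norm_eq_abs,
    Real.norm_eq_abs]
  linarith [abs_floor_div_sub_le B z.re, abs_floor_div_sub_le B z.im]

lemma abs_floor_le {B : ℕ} {y : ℝ} (h : |y| + 1 ≤ 2 ^ B) : |⌊y * 2 ^ B⌋| ≤ (4:ℤ) ^ B := by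
  have h2 : (1:ℝ) ≤ 2 ^ B := one_le_pow₀ (by norm_num)
  have h4 : (4:ℝ) ^ B = 2 ^ B * 2 ^ B := by rw [← mul_pow]; norm_num
  obtain ⟨h5, h6⟩ := abs_le.1 (show |y| ≤ 2 ^ B - 1 by linarith)
  rw [abs_le]
  constructor
  · rw [Int.le_floor]
    push_cast
    nlinarith
  · have : ((⌊y * 2 ^ B⌋ : ℤ) : ℝ) ≤ ((4:ℤ) ^ B : ℤ) := by
      refine (Int.floor_le _).trans ?_
      push_cast
      nlinarith
    exact_mod_cast this

lemma isBits_roundTo {B : ℕ} {z : ℂ} (h : ‖z‖ + 1 ≤ 2 ^ B) : IsBits B (roundTo B z) :=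
  ⟨_, _, abs_floor_le (by linarith [Complex.abs_re_le_norm z]),
    abs_floor_le (by linarith [Complex.abs_im_le_norm z]), rfl⟩

/-- A step whose result is real. -/
lemma exec_assign_real {B r : ℕ} {o : Op} {s : State} {y z : ℝ} {m : ℤ} (hdef : o.Defined s)
    (hv : o.value s = y) (h1 : (m:ℝ) ≤ y * 2 ^ B) (h2 : y * 2 ^ B < m + 1) (hz : z = m / 2 ^ B)
    (hm : |m| ≤ 4 ^ B) : Prog.Exec B (.assign r o) s 1 (Function.update s r (z:ℂ)) := by
  have hfl : ⌊y * 2 ^ B⌋ = m := Int.floor_eq_iff.2 ⟨h1, h2⟩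
  have hr : roundTo B (o.value s) = (z:ℂ) := by
    rw [hv, roundTo, hz]
    simp [hfl]
  have := Prog.Exec.assign (B := B) (r := r) hdef (by
    rw [hr]; exact ⟨m, 0, hm, by simp, by rw [hz]; push_cast; ring⟩)
  rwa [hr] at this

/-- A step whose real result is exactly representable. -/
lemma exec_assign_exact {B r : ℕ} {o : Op} {s : State} {z : ℝ} (m : ℤ) (hdef : o.Defined s)
    (hv : o.value s = z) (hz : z = m / 2 ^ B) (hm : |m| ≤ 4 ^ B) :
    Prog.Exec B (.assign r o) s 1 (Function.update s r (z:ℂ)) := by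
  have h2 : (0:ℝ) < 2 ^ B := by positivity
  have : z * 2 ^ B = m := by rw [hz]; field_simp
  exact exec_assign_real hdef hv this.ge (by linarith) hz hm

/-! ### Error propagation in straight-line programs -/

/-- Every register `i` with a tracked bound `(n, k)`, `k ≤ 40`, is within `Xᵏ 2⁻ᴮ` of `env i`, which
is at most `Xⁿ`. -/
def Approx (B : ℕ) (X : ℝ) (env : State) (bd : ℕ → ℕ × ℕ) (s : State) : Prop :=
  ∀ i, (bd i).2 ≤ 40 → ‖env i‖ ≤ X ^ (bd i).1 ∧ ‖s i - env i‖ ≤ X ^ (bd i).2 * (1 / 2 ^ B)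

/-- Propagation of the bounds through an operation. -/
def opBound (bd : ℕ → ℕ × ℕ) : Op → ℕ × ℕ
  | .const _ _ => (1, 1)
  | .pi => (1, 1)
  | .add i k => (max (bd i).1 (bd k).1 + 1, max (bd i).2 (bd k).2 + 1)
  | .mul i k => ((bd i).1 + (bd k).1, max ((bd i).1 + (bd k).2) ((bd k).1 + (bd i).2) + 1)
  -- An error exponent above `40` marks a register as untracked.
  | .log _ => (0, 41)
  | .exp i => (2, (bd i).2 + 3)

/-- What is needed of the exact operands for the bounds of `opBound` to hold. -/
def OpCond (X : ℝ) (env : State) : Op → Prop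
  | .const x y => |x| + |y| ≤ 2
  | .exp i => ‖Complex.exp (env i)‖ ≤ X ^ 2
  | _ => True

/-- The hypothesis `X ^ 40 ≤ 2 ^ B` keeps tracked errors at most `1`, so products of errors count as
first order and the exponential can be linearised. At most three error terms and the rounding error
`2 · 2⁻ᴮ` occur; one extra power of `X ≥ 5` absorbs them. -/
lemma norm_value_sub_le {B : ℕ} {X : ℝ} {env s : State} {bd : ℕ → ℕ × ℕ} {o : Op} (hX : 5 ≤ X)
    (hB : X ^ 40 ≤ 2 ^ B) (hs : Approx B X env bd s) (hc : OpCond X env o)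
    (hk : (opBound bd o).2 ≤ 40) :
    o.Defined s ∧ ‖o.value env‖ ≤ X ^ (opBound bd o).1 ∧
      ‖o.value s - o.value env‖ + 2 * (1 / 2 ^ B) ≤ X ^ (opBound bd o).2 * (1 / 2 ^ B) := by
  have hX1 : 1 ≤ X := by linarith
  have hX0 : 0 < X := by linarith
  set u : ℝ := 1 / 2 ^ B with hu
  have hu0 : 0 < u := by positivity
  have hpow {k : ℕ} (hk : k ≤ 40) : X ^ k * u ≤ 1 := by
    rw [hu, mul_one_div, div_le_one (by positivity)]
    exact (pow_le_pow_right₀ hX1 hk).trans hB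
  have hone (k : ℕ) : 1 ≤ X ^ k := one_le_pow₀ hX1
  cases o with
  | const x y =>
    refine ⟨trivial, ?_, ?_⟩
    · have hxy : |(x:ℝ)| + |(y:ℝ)| ≤ 2 := by
        have : |x| + |y| ≤ 2 := hc
        exact_mod_cast this
      simp only [Op.value, opBound, pow_one]
      refine (norm_add_le _ _).trans ?_
      rw [norm_mul, Complex.norm_I, mul_one, ← Complex.ofReal_ratCast, ← Complex.ofReal_ratCast,
        Complex.norm_real, Complex.norm_real, Real.norm_eq_abs, Real.norm_eq_abs]
      linarith
    · simp only [Op.value, opBound, pow_one, sub_self, norm_zero, zero_add]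
      gcongr; linarith
  | pi =>
    refine ⟨trivial, ?_, ?_⟩
    · simp only [Op.value, opBound, pow_one]
      rw [Complex.norm_real, Real.norm_eq_abs, abs_of_pos Real.pi_pos]
      linarith [Real.pi_lt_four]
    · simp only [Op.value, opBound, pow_one, sub_self, norm_zero, zero_add]
      gcongr; linarith
  | add i k =>
    simp only [opBound] at hk ⊢
    obtain ⟨hi1, hi2⟩ := hs i (by omega)
    obtain ⟨hk1, hk2⟩ := hs k (by omega)
    refine ⟨trivial, ?_, ?_⟩
    · simp only [Op.value]
      have h1 : X ^ (bd i).1 ≤ X ^ max (bd i).1 (bd k).1 := pow_le_pow_right₀ hX1 (le_max_left _ _)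
      have h2 : X ^ (bd k).1 ≤ X ^ max (bd i).1 (bd k).1 := pow_le_pow_right₀ hX1 (le_max_right _ _)
      have h3 := hone (max (bd i).1 (bd k).1)
      rw [pow_succ]
      have := norm_add_le (env i) (env k)
      nlinarith
    · simp only [Op.value]
      set mk := max (bd i).2 (bd k).2 with hmk
      have h1 : X ^ (bd i).2 * u ≤ X ^ mk * u := by
        gcongr
        exact le_max_left _ _
      have h2 : X ^ (bd k).2 * u ≤ X ^ mk * u := by
        gcongr
        exact le_max_right _ _
      have h3 : u ≤ X ^ mk * u := le_mul_of_one_le_left hu0.le (hone mk)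
      have h4 : ‖s i + s k - (env i + env k)‖ ≤ ‖s i - env i‖ + ‖s k - env k‖ := by
        rw [add_sub_add_comm]; exact norm_add_le _ _
      have h5 : X ^ (mk + 1) * u = X * (X ^ mk * u) := by rw [pow_succ]; ring
      have h6 : 5 * (X ^ mk * u) ≤ X * (X ^ mk * u) := by gcongr
      rw [h5]
      linarith
  | mul i k =>
    simp only [opBound] at hk ⊢
    obtain ⟨hi1, hi2⟩ := hs i (by omega)
    obtain ⟨hk1, hk2⟩ := hs k (by omega)
    refine ⟨trivial, ?_, ?_⟩
    · simp only [Op.value]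
      rw [norm_mul, pow_add]
      gcongr
    · simp only [Op.value]
      set mk := max ((bd i).1 + (bd k).2) ((bd k).1 + (bd i).2) with hmk
      have h1 : X ^ (bd i).1 * (X ^ (bd k).2 * u) ≤ X ^ mk * u := by
        rw [← mul_assoc, ← pow_add]
        gcongr
        exact le_max_left _ _
      have h2 : X ^ (bd k).1 * (X ^ (bd i).2 * u) ≤ X ^ mk * u := by
        rw [← mul_assoc, ← pow_add]
        gcongr
        exact le_max_right _ _
      have h3 : u ≤ X ^ mk * u := le_mul_of_one_le_left hu0.le (hone mk)
      have e : s i * s k - env i * env k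
          = env i * (s k - env k) + env k * (s i - env i) + (s i - env i) * (s k - env k) := by ring
      have h4 : ‖env i * (s k - env k)‖ ≤ X ^ mk * u := by
        rw [norm_mul]
        exact le_trans (by gcongr) h1
      have h5 : ‖env k * (s i - env i)‖ ≤ X ^ mk * u := by
        rw [norm_mul]
        exact le_trans (by gcongr) h2
      have h6 : ‖(s i - env i) * (s k - env k)‖ ≤ X ^ mk * u := by
        rw [norm_mul]
        have hk3 : ‖s k - env k‖ ≤ 1 := hk2.trans (hpow (by omega))
        calc ‖s i - env i‖ * ‖s k - env k‖ ≤ ‖s i - env i‖ * 1 := by gcongr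
          _ ≤ X ^ (bd i).2 * u := by rw [mul_one]; exact hi2
          _ ≤ X ^ (bd k).1 * (X ^ (bd i).2 * u) :=
            le_mul_of_one_le_left (by positivity) (hone _)
          _ ≤ _ := h2
      have h7 := norm_add₃_le (a := env i * (s k - env k)) (b := env k * (s i - env i))
        (c := (s i - env i) * (s k - env k))
      have h8 : X ^ (mk + 1) * u = X * (X ^ mk * u) := by rw [pow_succ]; ring
      have h9 : 5 * (X ^ mk * u) ≤ X * (X ^ mk * u) := by gcongr
      rw [e, h8]
      linarith
  | log i => simp [opBound] at hk
  | exp i =>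
    simp only [opBound] at hk ⊢
    obtain ⟨hi1, hi2⟩ := hs i (by omega)
    refine ⟨trivial, hc, ?_⟩
    simp only [Op.value]
    have hc' : ‖Complex.exp (env i)‖ ≤ X ^ 2 := hc
    have hd : ‖s i - env i‖ ≤ 1 := hi2.trans (hpow (by omega))
    have e : Complex.exp (s i) - Complex.exp (env i)
        = Complex.exp (env i) * (Complex.exp (s i - env i) - 1) := by
      rw [mul_sub, ← Complex.exp_add, mul_one, add_sub_cancel]
    have h1 := Complex.norm_exp_sub_one_le hd
    have h2 : ‖Complex.exp (s i) - Complex.exp (env i)‖ ≤ X ^ 2 * (2 * (X ^ (bd i).2 * u)) := by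
      rw [e, norm_mul]
      gcongr
      linarith
    have h3 : X ^ ((bd i).2 + 3) * u = X * (X ^ 2 * (X ^ (bd i).2 * u)) := by ring
    have h4 : u ≤ X ^ 2 * (X ^ (bd i).2 * u) := by
      rw [← mul_assoc, ← pow_add]
      exact le_mul_of_one_le_left hu0.le (hone _)
    have h5 : 5 * (X ^ 2 * (X ^ (bd i).2 * u)) ≤ X * (X ^ 2 * (X ^ (bd i).2 * u)) := by gcongr
    rw [h3]
    linarith

/-- The exponent `38` excludes overflow: value, error and the margin of `isBits_roundTo` fit below
`X⁴⁰ ≤ 2ᴮ`. -/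
lemma exec_assign_approx {B : ℕ} {X : ℝ} {env s : State} {bd : ℕ → ℕ × ℕ} {o : Op} (r : ℕ)
    (hX : 5 ≤ X) (hB : X ^ 40 ≤ 2 ^ B) (hs : Approx B X env bd s) (hc : OpCond X env o)
    (hn : (opBound bd o).1 ≤ 38) (hk : (opBound bd o).2 ≤ 40) :
    ∃ t, Prog.Exec B (.assign r o) s 1 t ∧
      Approx B X (Function.update env r (o.value env)) (Function.update bd r (opBound bd o)) t := by
  have hX1 : 1 ≤ X := by linarith
  obtain ⟨hdef, h1, h2⟩ := norm_value_sub_le hX hB hs hc hk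
  have hu0 : (0:ℝ) < 1 / 2 ^ B := by positivity
  refine ⟨_, Prog.Exec.assign hdef (isBits_roundTo ?_), ?_⟩
  · have h3 : X ^ (opBound bd o).2 * (1 / 2 ^ B) ≤ 1 := by
      rw [mul_one_div, div_le_one (by positivity)]
      exact (pow_le_pow_right₀ hX1 hk).trans hB
    have h4 : ‖o.value s‖ ≤ ‖o.value s - o.value env‖ + ‖o.value env‖ := by
      simpa using norm_add_le (o.value s - o.value env) (o.value env)
    have h5 : X ^ (opBound bd o).1 ≤ X ^ 38 := pow_le_pow_right₀ hX1 hn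
    have h6 : 1 ≤ X ^ 38 := one_le_pow₀ hX1
    have h7 : X ^ 38 * 5 ≤ X ^ 40 := by
      rw [pow_add X 38 2]
      gcongr
      nlinarith
    linarith
  · intro i hi
    by_cases hir : i = r
    · subst hir
      simp only [Function.update_self] at hi ⊢
      refine ⟨h1, ?_⟩
      have h3 := norm_roundTo_sub_le B (o.value s)
      have h4 : ‖roundTo B (o.value s) - o.value env‖
          ≤ ‖roundTo B (o.value s) - o.value s‖ + ‖o.value s - o.value env‖ := by
        simpa using norm_add_le (roundTo B (o.value s) - o.value s) (o.value s - o.value env)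
      linarith
    · simp only [Function.update_of_ne hir] at hi ⊢
      exact hs i hi

/-- Append a list of assignments to a program. -/
def appendOps (c : Prog) : List (ℕ × Op) → Prog
  | [] => c
  | x :: l => appendOps (.seq c (.assign x.1 x.2)) l

/-- The exact results of a list of assignments. -/
noncomputable def runExact (env : State) : List (ℕ × Op) → State
  | [] => env
  | x :: l => runExact (Function.update env x.1 (x.2.value env)) l

/-- The bounds after a list of assignments. -/
def runBound (bd : ℕ → ℕ × ℕ) : List (ℕ × Op) → ℕ → ℕ × ℕ
  | [] => bd
  | x :: l => runBound (Function.update bd x.1 (opBound bd x.2)) l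

/-- The bounds stay in the admissible range. -/
def BoundOk (bd : ℕ → ℕ × ℕ) : List (ℕ × Op) → Prop
  | [] => True
  | x :: l => ((opBound bd x.2).1 ≤ 38 ∧ (opBound bd x.2).2 ≤ 40) ∧
    BoundOk (Function.update bd x.1 (opBound bd x.2)) l

/-- The conditions on the exact operands hold. -/
def CondOk (X : ℝ) (env : State) : List (ℕ × Op) → Prop
  | [] => True
  | x :: l => OpCond X env x.2 ∧ CondOk X (Function.update env x.1 (x.2.value env)) l

lemma exec_appendOps {B : ℕ} {X : ℝ} (hX : 5 ≤ X) (hB : X ^ 40 ≤ 2 ^ B) {s₀ : State}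
    (l : List (ℕ × Op)) : ∀ {c : Prog} {n : ℕ} {env s : State} {bd : ℕ → ℕ × ℕ},
    Prog.Exec B c s₀ n s → Approx B X env bd s → BoundOk bd l → CondOk X env l →
    ∃ t, Prog.Exec B (appendOps c l) s₀ (n + l.length) t ∧
      Approx B X (runExact env l) (runBound bd l) t := by
  induction l with
  | nil => intro c n env s bd hc hs _ _; exact ⟨s, hc, hs⟩
  | cons x l ih =>
    intro c n env s bd hc hs hb hcond
    obtain ⟨t, ht, hat⟩ := exec_assign_approx x.1 hX hB hs hcond.1 hb.1.1 hb.1.2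
    obtain ⟨t', ht', hat'⟩ := ih (Prog.Exec.seq hc ht) hat hb.2 hcond.2
    refine ⟨t', ?_, hat'⟩
    rw [List.length_cons, show n + (l.length + 1) = n + 1 + l.length by ring]
    exact ht'

/-! ### The program -/

/-- One halving of register `22` and doubling of register `23`; register `24` becomes negative when
register `22` no longer changes under halving, and `25` is the negative of `22`. -/
def scaleBody : Prog :=
  .seq (.assign 22 (.mul 22 21)) <| .seq (.assign 23 (.add 23 23)) <|
  .seq (.assign 24 (.mul 22 21)) <| .seq (.assign 24 (.add 24 24)) <|
  .seq (.assign 25 (.mul 22 26)) (.assign 24 (.add 24 25))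

/-- Computes `2⁻ᴮ` in register `25` and `2ᴮ` in register `23`. -/
def scaleLoop : Prog := .whileNonneg 24 scaleBody

/-- State of the registers with `d` halvings to go. -/
structure ScaleInv (B d : ℕ) (s₀ s : State) : Prop where
  h21 : s 21 = ((1 / 2 : ℝ) : ℂ)
  h26 : s 26 = ((-1 : ℝ) : ℂ)
  h22 : s 22 = ((-(2 ^ d / 2 ^ B) : ℝ) : ℂ)
  h23 : s 23 = ((2 ^ (B - d) : ℝ) : ℂ)
  h24 : s 24 = ((if d = 0 then -(1 / 2 ^ B) else 0 : ℝ) : ℂ)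
  -- Register `25` is first written inside the loop.
  h25 : d < B → s 25 = ((2 ^ d / 2 ^ B : ℝ) : ℂ)
  frame : ∀ i, i ≠ 22 → i ≠ 23 → i ≠ 24 → i ≠ 25 → s i = s₀ i

lemma abs_two_pow_le {B d : ℕ} (h : d ≤ 2 * B) : |(2:ℤ) ^ d| ≤ 4 ^ B := by
  rw [abs_of_pos (by positivity), show (4:ℤ) = 2 ^ 2 by norm_num, ← pow_mul]
  exact pow_le_pow_right₀ (by norm_num) h

/-- Register `24` receives twice the rounded half of register `22`, minus register `22`. This is `0`
as long as halving is exact. At `-2⁻ᴮ` rounding down returns `-2⁻ᴮ` itself, and the difference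
becomes `-2⁻ᴮ < 0`, which stops the loop. -/
lemma exec_scaleBody {B d : ℕ} (hd : d + 1 ≤ B) {s₀ s : State} (h : ScaleInv B (d + 1) s₀ s) :
    ∃ t, Prog.Exec B scaleBody s 6 t ∧ ScaleInv B d s₀ t := by
  have h2B : (2:ℝ) ^ B ≠ 0 := by positivity
  have e1 := exec_assign_exact (B := B) (r := 22) (o := .mul 22 21) (s := s)
    (z := -(2 ^ d / 2 ^ B)) (-2 ^ d) trivial
    (by simp only [Op.value, h.h21, h.h22]; push_cast; ring) (by push_cast; ring)
    (by rw [abs_neg]; exact abs_two_pow_le (by omega))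
  set s1 := Function.update s 22 ((-(2 ^ d / 2 ^ B) : ℝ) : ℂ) with hs1
  have e2 := exec_assign_exact (B := B) (r := 23) (o := .add 23 23) (s := s1)
    (z := 2 ^ (B - d)) (2 ^ (B - d + B)) trivial
    (by
      rw [show B - d = B - (d + 1) + 1 by omega]
      simp only [Op.value, hs1, ne_eq, Nat.reduceEqDiff, not_false_eq_true,
        Function.update_of_ne, h.h23]
      push_cast; ring) (by push_cast; rw [pow_add]; field_simp)
    (abs_two_pow_le (by omega))
  set s2 := Function.update s1 23 ((2 ^ (B - d) : ℝ) : ℂ) with hs2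
  -- For `d = 0` the exact half is `-2⁻ᴮ/2`, and its floor in units of `2⁻ᴮ` is `-1`.
  have e3 : Prog.Exec B (.assign 24 (.mul 22 21)) s2 1 (Function.update s2 24
      (((if d = 0 then -1 else -2 ^ (d - 1) : ℝ) / 2 ^ B : ℝ) : ℂ)) := by
    refine exec_assign_real (y := -(2 ^ d / 2 ^ B) * (1 / 2))
      (m := if d = 0 then -1 else -2 ^ (d - 1)) trivial ?_ ?_ ?_ ?_ ?_
    · simp [Op.value, hs2, hs1, h.h21]
    · split_ifs with h0
      · subst h0; field_simp; norm_num
      · obtain ⟨k, rfl⟩ : ∃ k, d = k + 1 := ⟨d - 1, by omega⟩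
        simp only [Nat.add_sub_cancel]
        push_cast; field_simp; rw [pow_succ]
    · split_ifs with h0
      · subst h0; field_simp; norm_num
      · obtain ⟨k, rfl⟩ : ∃ k, d = k + 1 := ⟨d - 1, by omega⟩
        simp only [Nat.add_sub_cancel]
        push_cast; field_simp; rw [pow_succ]; linarith
    · split_ifs <;> push_cast <;> rfl
    · split_ifs with h0
      · simp; exact one_le_pow₀ (by norm_num)
      · rw [abs_neg]; exact abs_two_pow_le (by omega)
  set s3 := Function.update s2 24 (((if d = 0 then -1 else -2 ^ (d - 1) : ℝ) / 2 ^ B : ℝ) : ℂ)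
    with hs3
  have e4 : Prog.Exec B (.assign 24 (.add 24 24)) s3 1 (Function.update s3 24
      (((if d = 0 then -2 else -2 ^ d : ℝ) / 2 ^ B : ℝ) : ℂ)) := by
    refine exec_assign_exact (if d = 0 then -2 else -2 ^ d) trivial ?_ ?_ ?_
    · simp only [Op.value, hs3, Function.update_self]
      split_ifs with h0
      · push_cast; ring
      · obtain ⟨k, rfl⟩ : ∃ k, d = k + 1 := ⟨d - 1, by omega⟩
        simp only [Nat.add_sub_cancel]
        push_cast; ring
    · split_ifs <;> push_cast <;> rfl
    · split_ifs with h0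
      · rw [abs_neg]; exact abs_two_pow_le (d := 1) (by omega)
      · rw [abs_neg]; exact abs_two_pow_le (by omega)
  set s4 := Function.update s3 24 (((if d = 0 then -2 else -2 ^ d : ℝ) / 2 ^ B : ℝ) : ℂ) with hs4
  have e5 := exec_assign_exact (B := B) (r := 25) (o := .mul 22 26) (s := s4)
    (z := 2 ^ d / 2 ^ B) (2 ^ d) trivial
    (by simp [Op.value, hs4, hs3, hs2, hs1, h.h26]) (by push_cast; rfl)
    (abs_two_pow_le (by omega))
  set s5 := Function.update s4 25 ((2 ^ d / 2 ^ B : ℝ) : ℂ) with hs5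
  have e6 : Prog.Exec B (.assign 24 (.add 24 25)) s5 1 (Function.update s5 24
      ((if d = 0 then -(1 / 2 ^ B) else 0 : ℝ) : ℂ)) := by
    refine exec_assign_exact (if d = 0 then -1 else 0) trivial ?_ ?_ ?_
    · simp only [Op.value, hs5, hs4, ne_eq, Nat.reduceEqDiff,
        not_false_eq_true, Function.update_of_ne, Function.update_self]
      split_ifs with h0
      · subst h0; push_cast; ring
      · push_cast; ring
    · split_ifs <;> push_cast <;> ring
    · split_ifs
      · simp; exact one_le_pow₀ (by norm_num)
      · simp
  refine ⟨_, .seq e1 (.seq e2 (.seq e3 (.seq e4 (.seq e5 e6)))), ?_⟩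
  constructor
  · simp [hs5, hs4, hs3, hs2, hs1, h.h21]
  · simp [hs5, hs4, hs3, hs2, hs1, h.h26]
  · simp [hs5, hs4, hs3, hs2, hs1]
  · simp [hs5, hs4, hs3, hs2]
  · simp
  · intro _; simp [hs5]
  · intro i h22 h23 h24 h25
    simp [hs5, hs4, hs3, hs2, hs1, h22, h23, h24, h25, h.frame i]

lemma exec_scaleLoop {B : ℕ} {s₀ : State} (d : ℕ) : ∀ {s : State}, d ≤ B →
    ScaleInv B d s₀ s → ∃ t, Prog.Exec B scaleLoop s (7 * d + 1) t ∧ ScaleInv B 0 s₀ t := by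
  induction d with
  | zero =>
    intro s _ h
    refine ⟨s, .whileStop ?_, h⟩
    rw [h.h24, if_pos rfl, Complex.ofReal_re]
    have : (0:ℝ) < 1 / 2 ^ B := by positivity
    linarith
  | succ d ih =>
    intro s hd h
    obtain ⟨t, ht, hti⟩ := exec_scaleBody hd h
    obtain ⟨t', ht', hti'⟩ := ih (by omega) hti
    refine ⟨t', ?_, hti'⟩
    have := Prog.Exec.whileStep (r := 24) (by rw [h.h24]; simp) ht ht'
    rw [show 7 * (d + 1) + 1 = 6 + (7 * d + 1) + 1 by ring]
    exact this

/-- Leaves `log b` in register `20` and `⌊2bK⌋` in register `28`. -/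
def prelude : Prog :=
  .seq (.seq (.assign 20 (.log 2)) <| .seq (.assign 21 (.const (1 / 2) 0)) <|
    .seq (.assign 26 (.const (-1) 0)) <| .seq (.assign 22 (.const (-1) 0)) (.assign 23 (.const 1 0)))
  (.seq scaleLoop <| .seq (.assign 27 (.add 2 2)) <| .seq (.assign 27 (.mul 27 0)) <|
    .seq (.assign 27 (.mul 27 25)) (.assign 28 (.mul 27 23)))

lemma exec_prelude {B K : ℕ} {a b : ℝ} {k : ℕ} (hB : 1 ≤ B) (hb : 0 < b) (hb1 : b ≤ 1)
    (hlog : |Real.log b| + 1 ≤ 2 ^ B) (hbits : IsBits B b) (hk : (k:ℤ) = ⌊2 * b * K⌋)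
    (hK : (K:ℝ) * 2 ≤ 2 ^ B) :
    ∃ t, Prog.Exec B prelude (initState K a b) (7 * B + 10) t ∧
      t 0 = K ∧ t 1 = a ∧ t 2 = b ∧ t 12 = 0 ∧ t 14 = 0 ∧ t 28 = k ∧
      ‖t 20 - Real.log b‖ ≤ 2 * (1 / 2 ^ B) := by
  have h2B : (0:ℝ) < 2 ^ B := by positivity
  have h4B : (4:ℝ) ^ B = 2 ^ B * 2 ^ B := by rw [← mul_pow]; norm_num
  have hB2 : (2:ℝ) ≤ 2 ^ B := by
    calc (2:ℝ) = 2 ^ 1 := by norm_num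
      _ ≤ 2 ^ B := pow_le_pow_right₀ (by norm_num) hB
  obtain ⟨m, n, hm, hn, hmn⟩ := hbits
  have hbm : b = m / 2 ^ B := by
    have := congrArg Complex.re hmn
    have e : (((m : ℂ) + n * Complex.I) / 2 ^ B) = (((m / 2 ^ B : ℝ) : ℂ))
        + ((n / 2 ^ B : ℝ) : ℂ) * Complex.I := by push_cast; ring
    rwa [e, Complex.add_re, Complex.ofReal_re, Complex.ofReal_re, Complex.re_ofReal_mul,
      Complex.I_re, mul_zero, add_zero] at this
  set s := initState K a b with hs
  have e1 : Prog.Exec B (.assign 20 (.log 2)) s 1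
      (Function.update s 20 (roundTo B (Real.log b : ℂ))) := by
    have := Prog.Exec.assign (B := B) (r := 20) (o := .log 2) (s := s)
      (by simp [Op.Defined, hs, initState, hb]) (isBits_roundTo (by
        simpa [Op.value, hs, initState] using hlog))
    simpa [Op.value, hs, initState] using this
  set s1 := Function.update s 20 (roundTo B (Real.log b : ℂ)) with hs1
  have e2 := exec_assign_exact (B := B) (r := 21) (o := .const (1 / 2) 0) (s := s1)
    (z := 1 / 2) (2 ^ (B - 1)) trivial (by simp [Op.value]) (by
      obtain ⟨k, rfl⟩ : ∃ k, B = k + 1 := ⟨B - 1, by omega⟩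
      push_cast
      rw [pow_succ]; field_simp)
    (abs_two_pow_le (by omega))
  set s2 := Function.update s1 21 ((1 / 2 : ℝ) : ℂ) with hs2
  have e3 := exec_assign_exact (B := B) (r := 26) (o := .const (-1) 0) (s := s2)
    (z := -1) (-2 ^ B) trivial (by simp [Op.value]) (by push_cast; field_simp)
    (by rw [abs_neg]; exact abs_two_pow_le (by omega))
  set s3 := Function.update s2 26 ((-1 : ℝ) : ℂ) with hs3
  have e4 := exec_assign_exact (B := B) (r := 22) (o := .const (-1) 0) (s := s3)
    (z := -(2 ^ B / 2 ^ B)) (-2 ^ B) trivial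
    (by simp only [Op.value, div_self h2B.ne']; simp)
    (by push_cast; ring)
    (by rw [abs_neg]; exact abs_two_pow_le (by omega))
  set s4 := Function.update s3 22 ((-(2 ^ B / 2 ^ B) : ℝ) : ℂ) with hs4
  have e5 := exec_assign_exact (B := B) (r := 23) (o := .const 1 0) (s := s4)
    (z := 2 ^ (B - B)) (2 ^ B) trivial (by simp [Op.value])
    (by push_cast; rw [Nat.sub_self]; field_simp)
    (abs_two_pow_le (by omega))
  set s5 := Function.update s4 23 ((2 ^ (B - B) : ℝ) : ℂ) with hs5
  have hinv : ScaleInv B B s5 s5 := by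
    constructor
    · simp [hs5, hs4, hs3, hs2]
    · simp [hs5, hs4, hs3]
    · simp [hs5, hs4]
    · simp [hs5]
    · rw [if_neg (by omega)]; simp [hs5, hs4, hs3, hs2, hs1, hs, initState]
    · intro h; exact absurd h (lt_irrefl _)
    · intros; rfl
  obtain ⟨t, ht, hti⟩ := exec_scaleLoop B le_rfl hinv
  have htf : ∀ i, i ∉ ({20, 21, 22, 23, 24, 25, 26} : Finset ℕ) → t i = s i := by
    intro i hi
    simp only [Finset.mem_insert, Finset.mem_singleton, not_or] at hi
    obtain ⟨i0, i1, i2, i3, i4, i5, i6⟩ := hi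
    rw [hti.frame i i2 i3 i4 i5]
    simp [hs5, hs4, hs3, hs2, hs1, i0, i1, i2, i3, i6]
  have t0 : t 0 = K := by rw [htf 0 (by decide)]; simp [hs, initState]
  have t1 : t 1 = a := by rw [htf 1 (by decide)]; simp [hs, initState]
  have t2 : t 2 = b := by rw [htf 2 (by decide)]; simp [hs, initState]
  have t12 : t 12 = 0 := by rw [htf 12 (by decide)]; simp [hs, initState]
  have t14 : t 14 = 0 := by rw [htf 14 (by decide)]; simp [hs, initState]
  have t20 : t 20 = roundTo B (Real.log b : ℂ) := by
    rw [hti.frame 20 (by decide) (by decide) (by decide) (by decide)]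
    simp [hs5, hs4, hs3, hs2, hs1]
  have t25 := hti.h25 (by omega)
  have t23 := hti.h23
  rw [Nat.sub_zero] at t23
  have hmb : (m:ℝ) = b * 2 ^ B := by rw [hbm]; field_simp
  have habs : ∀ {z : ℤ}, 0 ≤ (z:ℝ) → (z:ℝ) ≤ 2 ^ B * 2 ^ B → |z| ≤ 4 ^ B := by
    intro z hz0 hz
    rw [abs_of_nonneg (by exact_mod_cast hz0)]
    rw [← h4B] at hz
    exact_mod_cast hz
  have hK0 : (0:ℝ) ≤ K := by positivity
  have f1 := exec_assign_exact (B := B) (r := 27) (o := .add 2 2) (s := t)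
    (z := 2 * b) (2 * m) trivial (by simp only [Op.value, t2]; push_cast; ring)
    (by push_cast; rw [hmb]; field_simp)
    (habs (by push_cast; rw [hmb]; positivity) (by push_cast; rw [hmb]; nlinarith))
  set u1 := Function.update t 27 ((2 * b : ℝ) : ℂ) with hu1
  -- No rounding occurs: `b` has `B` binary places and `K` is an integer.
  have f2 := exec_assign_exact (B := B) (r := 27) (o := .mul 27 0) (s := u1)
    (z := 2 * b * K) (2 * m * K) trivial
    (by simp [Op.value, hu1, t0])
    (by push_cast; rw [hmb]; field_simp)
    (habs (by push_cast; rw [hmb]; positivity) (by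
      push_cast; rw [hmb]
      calc 2 * (b * 2 ^ B) * (K:ℝ) = b * (K * 2) * 2 ^ B := by ring
        _ ≤ 1 * 2 ^ B * 2 ^ B := by gcongr
        _ = _ := by ring))
  set u2 := Function.update u1 27 ((2 * b * K : ℝ) : ℂ) with hu2
  have hfl1 : ((k:ℤ):ℝ) ≤ 2 * b * K := by rw [hk]; exact Int.floor_le _
  have hfl2 : 2 * b * K < ((k:ℤ):ℝ) + 1 := by rw [hk]; exact Int.lt_floor_add_one _
  have hk2 : ((k:ℤ):ℝ) ≤ 2 ^ B := by nlinarith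
  have hk0 : (0:ℝ) ≤ ((k:ℤ):ℝ) := by push_cast; positivity
  -- Multiplication by `2⁻ᴮ` moves the fractional part of `2bK` beyond the last binary place, so
  -- rounding down takes the floor; multiplication by `2ᴮ` restores the scale.
  have f3 : Prog.Exec B (.assign 27 (.mul 27 25)) u2 1
      (Function.update u2 27 (((k:ℤ) / 2 ^ B : ℝ) : ℂ)) := by
    refine exec_assign_real (y := 2 * b * K / 2 ^ B) (m := k) trivial ?_ ?_ ?_ rfl ?_
    · simp [Op.value, hu2, hu1, t25]; ring
    · rw [div_mul_cancel₀ _ h2B.ne']; exact hfl1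
    · rw [div_mul_cancel₀ _ h2B.ne']; exact hfl2
    · exact habs hk0 (by nlinarith)
  set u3 := Function.update u2 27 (((k:ℤ) / 2 ^ B : ℝ) : ℂ) with hu3
  have f4 := exec_assign_exact (B := B) (r := 28) (o := .mul 27 23) (s := u3)
    (z := k) (k * 2 ^ B) trivial
    (by
      have : (2:ℂ) ^ B ≠ 0 := pow_ne_zero _ two_ne_zero
      simp [Op.value, hu3, hu2, hu1, t23])
    (by push_cast; field_simp)
    (habs (by push_cast; positivity) (by push_cast at hk2 ⊢; nlinarith))
  refine ⟨Function.update u3 28 ((k:ℝ):ℂ), ?_, ?_, ?_, ?_, ?_, ?_, ?_, ?_⟩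
  · have := Prog.Exec.seq (.seq e1 (.seq e2 (.seq e3 (.seq e4 e5))))
      (.seq ht (.seq f1 (.seq f2 (.seq f3 f4))))
    rw [show 7 * B + 10 = 1 + (1 + (1 + (1 + 1))) + (7 * B + 1 + (1 + (1 + (1 + 1)))) by ring]
    exact this
  · simp [hu3, hu2, hu1, t0]
  · simp [hu3, hu2, hu1, t1]
  · simp [hu3, hu2, hu1, t2]
  · simp [hu3, hu2, hu1, t12]
  · simp [hu3, hu2, hu1, t14]
  · rw [Function.update_self]; push_cast; rfl
  · simp only [hu3, hu2, hu1, ne_eq, Nat.reduceEqDiff, not_false_eq_true,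
      Function.update_of_ne, t20]
    exact norm_roundTo_sub_le B _

/-- The straight-line part of the program: from the approximations of `K, a, b` (registers `0, 1, 2`),
`log b` (register `20`) and `⌊2bK⌋` (register `28`) it computes the coefficients. -/
def coefOps : List (ℕ × Op) :=
  [(40, .const 0 2), (41, .pi), (42, .mul 40 41), (43, .const (-1) 0), (44, .const (1 / 2) 0),
    -- With no division available, `1/(2b)` is obtained as half of `exp(-log b)`.
    (45, .mul 20 43), (46, .exp 45), (47, .mul 46 44),
    (48, .mul 2 0), (49, .add 1 48), (50, .mul 49 0), (51, .mul 50 42), (52, .exp 51),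
    (53, .const (-1 / 2) 0), (54, .const 1 0),
    (55, .add 1 53), (56, .mul 55 47), (57, .mul 56 42), (58, .exp 57),
    (59, .add 28 54), (60, .mul 59 53), (61, .add 1 60), (62, .mul 61 59), (63, .mul 62 47),
    (64, .mul 63 42), (65, .exp 64),
    (66, .add 59 54), (67, .mul 66 53), (68, .add 1 67), (69, .mul 68 66), (70, .mul 69 47),
    (71, .mul 70 42), (72, .exp 71),
    (73, .const (1 / 8) 0), (74, .mul 42 73), (75, .exp 74), (76, .const 0 1), (77, .const 0 (-1)),
    -- The inputs are no longer needed and may be overwritten. Registers `12` and `14` keep their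
    -- initial `0`, which is the right coefficient.
    (0, .const (1 / 2) 0), (1, .const 0 (-1)), (2, .mul 52 77), (3, .const 0 (-1)),
    (4, .mul 52 77), (5, .const 0 1), (6, .mul 52 76), (7, .const 0 1), (8, .mul 52 76),
    (9, .const 0 (-1)), (10, .mul 52 77), (11, .mul 75 43), (13, .mul 52 44), (15, .mul 11 58),
    (16, .mul 75 65), (17, .mul 75 65), (18, .mul 75 72)]

/-- The exact contents of the registers before `coefOps`. -/
noncomputable def env₀ (K k : ℕ) (a b : ℝ) : State := fun r =>
  if r = 0 then K else if r = 1 then a else if r = 2 then b else if r = 20 then Real.log b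
    else if r = 28 then k else 0

/-- The bounds on the registers before `coefOps`. -/
def bound₀ : ℕ → ℕ × ℕ := fun r =>
  if r = 0 then (1, 0) else if r = 1 then (1, 0) else if r = 2 then (0, 0)
    -- The exponents for `log b` come from `|log b| ≤ 2K ≤ X²` and an error of at most `(2 +
    -- 2K)2⁻ᴮ`.
    else if r = 20 then (2, 3) else if r = 28 then (1, 0) else if r = 12 ∨ r = 14 then (0, 0)
    else (0, 41)

lemma boundOk_coefOps : BoundOk bound₀ coefOps := by
  simp [BoundOk, coefOps, opBound, bound₀]

/-- Two of the forty powers are kept in reserve: `X³⁸ 2⁻ᴮ ≤ X⁻²`, which is below `ε/K²`. -/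
lemma bound_coefOps : ∀ i < 19, (runBound bound₀ coefOps i).2 ≤ 38 := by
  simp [runBound, coefOps, opBound, bound₀]
  intro i hi
  interval_cases i <;> simp [bound₀]

/-! ### Identification of the exact register contents with the coefficients. -/

lemma exp_phase_eq (K : ℕ) (a b : ℝ) :
    Complex.exp ((a + b * K) * K * (2 * Complex.I * Real.pi)) = quadExp b a K := by
  unfold quadExp; congr 1; ring

lemma exp_eighth_eq : Complex.exp (2 * Complex.I * Real.pi * 8⁻¹) = e8 := by
  unfold e8; congr 1; ring

lemma exp_neg_log_eq {b : ℝ} (hb : 0 < b) : Complex.exp (-(Real.log b : ℂ)) = (b:ℂ)⁻¹ := by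
  rw [Complex.exp_neg, ← Complex.ofReal_exp, Real.exp_log hb]

lemma exp_saddle_eq {b : ℝ} (hb : 0 < b) (a : ℝ) (m : ℕ) :
    Complex.exp ((a + m * (-1 / 2)) * m * ((b:ℂ)⁻¹ * 2⁻¹) * (2 * Complex.I * Real.pi))
      = saddlePhase a b m := by
  have hbc : (b:ℂ) ≠ 0 := by exact_mod_cast hb.ne'
  unfold saddlePhase quadExp
  congr 1
  push_cast
  field_simp
  ring

lemma exp_saddle_one_eq {b : ℝ} (hb : 0 < b) (a : ℝ) :
    Complex.exp ((a + -1 / 2) * ((b:ℂ)⁻¹ * 2⁻¹) * (2 * Complex.I * Real.pi))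
      = saddlePhase a b 1 := by
  rw [← exp_saddle_eq hb]; push_cast; ring_nf

lemma exp_saddle_succ_eq {b : ℝ} (hb : 0 < b) (a : ℝ) (m : ℕ) :
    Complex.exp ((a + (m + 1) * (-1 / 2)) * (m + 1) * ((b:ℂ)⁻¹ * 2⁻¹) * (2 * Complex.I * Real.pi))
      = saddlePhase a b (m + 1) := by
  rw [← exp_saddle_eq hb]; push_cast; rfl

lemma exp_saddle_succ_succ_eq {b : ℝ} (hb : 0 < b) (a : ℝ) (m : ℕ) :
    Complex.exp ((a + (m + 1 + 1) * (-1 / 2)) * (m + 1 + 1) * ((b:ℂ)⁻¹ * 2⁻¹)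
      * (2 * Complex.I * Real.pi)) = saddlePhase a b (m + 2) := by
  rw [← exp_saddle_eq hb]; push_cast; ring_nf

lemma runExact_coefOps {K : ℕ} {a b : ℝ} (hb : 0 < b) (i : Fin 19) :
    runExact (env₀ K (Kstar K b) a b) coefOps i = coef K a b i := by
  simp only [runExact, coefOps, Op.value, env₀, ne_eq, Nat.reduceEqDiff, not_false_eq_true,
    Function.update_of_ne, Function.update_self, OfNat.ofNat_ne_zero, OfNat.ofNat_ne_one, if_true,
    if_false, one_ne_zero, zero_ne_one]
  fin_cases i <;>
  simp [coef, env₀, exp_phase_eq, exp_eighth_eq, exp_neg_log_eq hb, exp_saddle_one_eq hb,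
    exp_saddle_succ_eq hb, exp_saddle_succ_succ_eq hb]
  rw [div_eq_mul_inv]

/-- All exponentials computed are unimodular except `exp(-log b) = 1/b`. -/
lemma condOk_coefOps {X : ℝ} {K : ℕ} {a b : ℝ} (hb : 0 < b) (hX : 1 ≤ X) (hbX : 1 / b ≤ X ^ 2) :
    CondOk X (env₀ K (Kstar K b) a b) coefOps := by
  have h1 : 1 ≤ X ^ 2 := one_le_pow₀ hX
  have h2 : |b|⁻¹ ≤ X ^ 2 := by rwa [abs_of_pos hb, ← one_div]
  simp [CondOk, coefOps, OpCond, Op.value, env₀, exp_phase_eq, exp_eighth_eq, exp_neg_log_eq hb,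
    exp_saddle_one_eq hb, exp_saddle_succ_eq hb, exp_saddle_succ_succ_eq hb, norm_e8,
    norm_saddlePhase, norm_quadExp_natCast, h1, h2]
  norm_num [abs_le]

/-- The program computing the coefficients. -/
def coefProg : Prog := appendOps prelude coefOps

/-- The factor `60` suffices because `60 log 2 > 40`. -/
lemma rpow_le_two_pow_ceil {X : ℝ} (hX : 1 ≤ X) : X ^ 40 ≤ 2 ^ ⌈60 * Real.log X⌉₊ := by
  have hX0 : 0 < X := by linarith
  have hlog : 0 ≤ Real.log X := Real.log_nonneg hX
  have h1 := Nat.le_ceil (60 * Real.log X)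
  have h2 := Real.log_two_gt_d9
  rw [← Real.log_le_log_iff (by positivity) (by positivity), Real.log_pow, Real.log_pow]
  push_cast
  nlinarith

/-- From `log x - log y ≤ (x - y)/y` and `1/y ≤ 2K`: the logarithm loses only a factor `2K` of
accuracy although `b` may be small. -/
lemma abs_log_sub_log_le {x y d : ℝ} {K : ℕ} (hK : 0 < K) (hx : 1 ≤ 2 * x * K) (hy : 1 ≤ 2 * y * K)
    (hd : |x - y| ≤ d) : |Real.log x - Real.log y| ≤ 2 * K * d := by
  have hK' : (0:ℝ) < K := by exact_mod_cast hK
  have aux : ∀ {x y : ℝ}, 1 ≤ 2 * x * K → 1 ≤ 2 * y * K → |x - y| ≤ d →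
      Real.log x - Real.log y ≤ 2 * K * d := by
    intro x y hx hy hd
    have hx0 : 0 < x := by
      by_contra h
      nlinarith
    have hy0 : 0 < y := by
      by_contra h
      nlinarith
    rw [← Real.log_div hx0.ne' hy0.ne']
    refine (Real.log_le_sub_one_of_pos (by positivity)).trans ?_
    have h1 : x - y ≤ d := (le_abs_self _).trans hd
    have hd0 : 0 ≤ d := (abs_nonneg _).trans hd
    rw [div_sub_one hy0.ne', div_le_iff₀ hy0]
    nlinarith
  rw [abs_le]
  constructor
  · have := aux hy hx (by rwa [abs_sub_comm])
    linarith
  · exact aux hx hy hd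

/-- The program computes the coefficients with the claimed accuracy and operation count. -/
lemma exec_coefProg {K : ℕ} {ε a b : ℝ} (hK : 0 < K) (hε : 0 < ε) (hε1 : ε < Real.exp (-1))
    (ha : a ∈ Set.Icc (0 : ℝ) 2) (hb4 : b ≤ 1 / 4) (h2bK : 1 ≤ 2 * b * K)
    {B : ℕ} {a' b' : ℝ} (hB : B = ⌈60 * nu K ε⌉₊) (hbits : IsBits B b')
    (ha' : |a' - a| ≤ 1 / 2 ^ B) (hb' : |b' - b| ≤ 1 / 2 ^ B)
    (hfl : ⌊2 * b' * K⌋ = ⌊2 * b * K⌋) :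
    ∃ (n : ℕ) (s : State), coefProg.Exec B (initState K a' b') n s ∧
      (n : ℝ) ≤ 500 * nu K ε ∧ ∀ i : Fin 19, ‖s i - coef K a b i‖ ≤ ε / (K : ℝ) ^ 2 := by
  have hKpos : (0:ℝ) < K := by exact_mod_cast hK
  have hb : 0 < b := by
    by_contra h
    nlinarith
  have hK2 : (2:ℝ) ≤ K := by nlinarith
  obtain ⟨X, hX⟩ : ∃ X : ℝ, X = K / ε := ⟨_, rfl⟩
  -- The condition `ε < e⁻¹` enters here; with `K ≥ 2` it gives the `X ≥ 5` required by the error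
  -- calculus.
  have hKX : K * 2.7 ≤ X := by
    rw [hX, le_div_iff₀ hε]
    have h1 : ε * Real.exp 1 ≤ 1 := by
      have : ε * Real.exp 1 ≤ Real.exp (-1) * Real.exp 1 := by gcongr
      rwa [← Real.exp_add, neg_add_cancel, Real.exp_zero] at this
    have h2 := Real.exp_one_gt_d9
    have h3 : 2.7 * ε ≤ 1 := by nlinarith
    nlinarith
  have hX5 : 5 ≤ X := by linarith
  have hX1 : 1 ≤ X := by linarith
  have hX0 : 0 < X := by linarith
  have hnu : nu K ε = Real.log X := by rw [nu, hX]
  have hnu1 : 1 ≤ nu K ε := by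
    rw [hnu, Real.le_log_iff_exp_le hX0]
    linarith [Real.exp_one_lt_d9]
  have hB40 : X ^ 40 ≤ 2 ^ B := by rw [hB, hnu]; exact rpow_le_two_pow_ceil hX1
  have hX2B : X ^ 2 ≤ 2 ^ B := (pow_le_pow_right₀ hX1 (by norm_num)).trans hB40
  have hB1 : 1 ≤ B := by
    by_contra h
    have : B = 0 := by omega
    rw [this] at hX2B
    nlinarith
  set u : ℝ := 1 / 2 ^ B with hu
  have hu0 : 0 < u := by positivity
  have hu1 : u ≤ 1 / 2 := by
    rw [hu]
    apply one_div_le_one_div_of_le (by norm_num)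
    nlinarith
  -- The equality of floors transfers the lower bound to `b'`, so that the logarithm is defined and
  -- controlled.
  have h2bK' : 1 ≤ 2 * b' * K := by
    have h1 : (1:ℤ) ≤ ⌊2 * b * K⌋ := Int.le_floor.2 (by exact_mod_cast h2bK)
    rw [← hfl] at h1
    exact_mod_cast Int.le_floor.1 h1
  have hb'0 : 0 < b' := by
    by_contra h
    nlinarith
  have hb'1 : b' ≤ 1 := by
    have := (le_abs_self _).trans hb'
    linarith
  have hlog : ∀ {y : ℝ}, 0 < y → y ≤ 1 → 1 ≤ 2 * y * K → |Real.log y| ≤ 2 * K := by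
    intro y hy0 hy1 hy
    rw [abs_of_nonpos (Real.log_nonpos hy0.le hy1), ← Real.log_inv]
    refine (Real.log_le_self (by positivity)).trans ?_
    rw [inv_le_iff_one_le_mul₀ hy0]
    linarith
  have hk : ((Kstar K b : ℕ) : ℤ) = ⌊2 * b' * K⌋ := by
    rw [hfl, Kstar, Int.natCast_floor_eq_floor (by positivity)]
  obtain ⟨t, ht, t0, t1, t2, t12, t14, t28, t20⟩ := exec_prelude (B := B) (K := K) (a := a') (b := b')
    (k := Kstar K b) hB1 hb'0 hb'1
    (by have := hlog hb'0 hb'1 h2bK'; nlinarith) hbits hk (by nlinarith)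
  rw [← hu] at t20
  have happ : Approx B X (env₀ K (Kstar K b) a b) bound₀ t := by
    intro i hi
    have hcases : i = 0 ∨ i = 1 ∨ i = 2 ∨ i = 20 ∨ i = 28 ∨ i = 12 ∨ i = 14 := by
      by_contra hne
      simp only [not_or] at hne
      obtain ⟨h0, h1, h2, h3, h4, h5, h6⟩ := hne
      simp [bound₀, h0, h1, h2, h3, h4, h5, h6] at hi
    rw [← hu]
    rcases hcases with rfl | rfl | rfl | rfl | rfl | rfl | rfl
    · simp only [env₀, bound₀, if_true, pow_one, pow_zero, one_mul, t0, sub_self, norm_zero]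
      refine ⟨?_, hu0.le⟩
      rw [Complex.norm_natCast]; linarith
    · simp only [env₀, bound₀, one_ne_zero, if_false, if_true, pow_one, pow_zero, one_mul, t1]
      rw [← Complex.ofReal_sub, Complex.norm_real, Complex.norm_real, Real.norm_eq_abs,
        Real.norm_eq_abs, abs_of_nonneg ha.1]
      exact ⟨by linarith [ha.2], ha'⟩
    · simp only [env₀, bound₀, OfNat.ofNat_ne_zero, OfNat.ofNat_ne_one, if_false, if_true, pow_zero,
        one_mul, t2]
      rw [← Complex.ofReal_sub, Complex.norm_real, Complex.norm_real, Real.norm_eq_abs,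
        Real.norm_eq_abs, abs_of_nonneg hb.le]
      exact ⟨by linarith, hb'⟩
    · have e : env₀ K (Kstar K b) a b 20 = Real.log b := by simp [env₀]
      have e' : bound₀ 20 = (2, 3) := by simp [bound₀]
      rw [e, e']
      constructor
      · rw [Complex.norm_real, Real.norm_eq_abs]
        refine (hlog hb (by linarith) h2bK).trans ?_
        show 2 * (K:ℝ) ≤ X ^ 2
        nlinarith
      · have h1 := abs_log_sub_log_le hK h2bK' h2bK hb'
        have h2 : ‖t 20 - Real.log b‖ ≤ ‖t 20 - Real.log b'‖ + ‖(Real.log b' : ℂ) - Real.log b‖ := by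
          simpa using norm_add_le (t 20 - Real.log b') ((Real.log b' : ℂ) - Real.log b)
        rw [← Complex.ofReal_sub, Complex.norm_real, Real.norm_eq_abs] at h2
        show ‖t 20 - Real.log b‖ ≤ X ^ 3 * u
        have h3 : 2 + 2 * (K:ℝ) ≤ X ^ 3 := by
          have : X * 25 ≤ X ^ 3 := by nlinarith
          linarith
        calc ‖t 20 - Real.log b‖ ≤ (2 + 2 * K) * u := by linarith
          _ ≤ _ := by gcongr
    · have e : env₀ K (Kstar K b) a b 28 = Kstar K b := by simp [env₀]
      have e' : bound₀ 28 = (1, 0) := by simp [bound₀]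
      rw [e, e', t28, sub_self, norm_zero, Complex.norm_natCast]
      refine ⟨?_, by positivity⟩
      have h1 : ((Kstar K b : ℕ) : ℝ) ≤ 2 * b * K := Nat.floor_le (by positivity)
      show ((Kstar K b : ℕ) : ℝ) ≤ X ^ 1
      nlinarith
    · have e : env₀ K (Kstar K b) a b 12 = 0 := by simp [env₀]
      rw [e, t12, sub_self, norm_zero]
      exact ⟨by positivity, by positivity⟩
    · have e : env₀ K (Kstar K b) a b 14 = 0 := by simp [env₀]
      rw [e, t14, sub_self, norm_zero]
      exact ⟨by positivity, by positivity⟩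
  obtain ⟨s, hs, hsa⟩ := exec_appendOps hX5 hB40 coefOps ht happ boundOk_coefOps
    (condOk_coefOps hb hX1 (by
      rw [div_le_iff₀ hb]
      have h1 : (2 * K) * b ≤ X ^ 2 * b := by
        gcongr
        nlinarith
      linarith))
  refine ⟨_, s, hs, ?_, ?_⟩
  -- The count is `7B + 10 + 55`, below `420ν + 72 ≤ 500ν` since `ν ≥ 1`.
  · have h1 : (B:ℝ) < 60 * nu K ε + 1 := by rw [hB]; exact Nat.ceil_lt_add_one (by linarith)
    have h2 : coefOps.length = 55 := rfl
    rw [h2]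
    push_cast
    linarith
  · intro i
    have h1 := bound_coefOps i i.2
    obtain ⟨-, h2⟩ := hsa i (by omega)
    rw [runExact_coefOps hb, ← hu] at h2
    refine h2.trans ?_
    have h3 : X ^ (runBound bound₀ coefOps i).2 * u ≤ X ^ 38 * u := by gcongr
    refine h3.trans ?_
    have h4 : X ^ 38 * u * X ^ 2 ≤ 1 := by
      have : X ^ 38 * u * X ^ 2 = X ^ 40 / 2 ^ B := by rw [hu]; ring
      rw [this, div_le_one (by positivity)]
      exact hB40
    -- As `ε = K/X`, the target accuracy is `1/(XK)`, which is at least `X⁻²`.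
    have h5 : ε / (K:ℝ) ^ 2 = 1 / (X * K) := by rw [hX]; field_simp
    rw [h5, le_div_iff₀ (by positivity)]
    refine le_trans ?_ h4
    have : X * K ≤ X ^ 2 := by nlinarith
    gcongr

end TruncTheta

/-! ### The theorem. -/

theorem lemma6p6 :
    ∃ (P : TruncTheta.Prog) (A₁ A₂ A₃ : ℝ), 0 < A₁ ∧ 0 < A₂ ∧ 0 < A₃ ∧
      ∀ (K : ℕ) (ε α a b : ℝ), 0 < K → 0 < ε → ε < Real.exp (-1) →
        α ∈ Set.Icc (-1 : ℝ) 1 → a ∈ Set.Icc (0 : ℝ) 2 → b ∈ Set.Icc (0 : ℝ) (1 / 4) →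
        (∀ x ∈ Set.Icc (-(1 / 4) : ℝ) (1 / 4),
          TruncTheta.p (a + α * x) < TruncTheta.q K (a + α * x) b ∧
            a + α * x ∈ Set.Ioo (0 : ℝ) 2) →
        ∃ c : Fin 19 → ℂ,
          -- the coefficients are bounded and do not depend on `x`
          (∀ i, ‖c i‖ ≤ A₁) ∧
          (∀ x ∈ Set.Icc (-(1 / 4) : ℝ) (1 / 4),
            ‖TruncTheta.F K 0 (a + α * x) b
                - (Complex.exp (Real.pi * Complex.I / 4) * TruncTheta.gauss (a + α * x) b
                    * TruncTheta.F (TruncTheta.Kstar K b) 0 ((a + α * x) / (2 * b)) (-(1 / (4 * b)))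
                  + ∑ i, c i * TruncTheta.remFun K ε α a b x i)‖
              ≤ A₁ * (ε / (K : ℝ) ^ 2 + Real.exp (-(K : ℝ)))) ∧
          -- they are computed to within `ε/K²` by `O(ν)` operations on numbers of `O(ν)` bits
          (∀ (B : ℕ) (a' b' : ℝ), B = ⌈A₃ * TruncTheta.nu K ε⌉₊ →
            TruncTheta.IsBits B a' → TruncTheta.IsBits B b' →
            |a' - a| ≤ 1 / 2 ^ B → |b' - b| ≤ 1 / 2 ^ B →
            ⌊2 * b' * K⌋ = ⌊2 * b * K⌋ →
            ∃ (n : ℕ) (s : TruncTheta.State),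
              P.Exec B (TruncTheta.initState K a' b') n s ∧
              (n : ℝ) ≤ A₂ * TruncTheta.nu K ε ∧
              ∀ i : Fin 19, ‖s i - c i‖ ≤ ε / (K : ℝ) ^ 2) := by
  -- The constant `12` is that of `norm_theta_sub_le` and also covers the coefficients, of modulus
  -- at most `1`; `500` is the operation count per unit of `ν`, and `60` the precision in bits.
  refine ⟨TruncTheta.coefProg, 12, 500, 60, by norm_num, by norm_num, by norm_num, ?_⟩
  intro K ε α a b hK hε hε1 _ ha hb hx
  have h2bK : 1 ≤ 2 * b * K := by
    -- At `x = 0` the window condition reads `p_a + 1 ≤ q_a`, hence `a + 1 ≤ a + 2bK`.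
    have h0 := (hx 0 ⟨by norm_num, by norm_num⟩).1
    rw [mul_zero, add_zero] at h0
    have h1 : ((TruncTheta.p a : ℤ) : ℝ) + 1 ≤ TruncTheta.q K a b := by exact_mod_cast h0
    have h2 : a ≤ TruncTheta.p a := Int.le_ceil a
    have h3 : (TruncTheta.q K a b : ℝ) ≤ a + 2 * b * K := Int.floor_le _
    linarith
  refine ⟨TruncTheta.coef K a b, fun i => (TruncTheta.norm_coef_le K a b i).trans (by norm_num),
    fun x hxm => TruncTheta.norm_F_sub_le hK hε hb.1 hb.2 (hx x hxm).1 (hx x hxm).2, ?_⟩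
  intro B a' b' hB _ hbits ha' hb' hfl
  exact TruncTheta.exec_coefProg hK hε hε1 ha hb.2 h2bK hB hbits ha' hb' hfl
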